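/- **Setting.** Let $n\ge 0$, $p\ge 1$, let $\mathcal Z$ be a compact metric space and $\mu$ a Borel probability measure on $\mathcal Z$ with support $\mathcal Z$. Let $\psi_1,\dots,\psi_p$ be (jointly measurable) real random functions on $\mathcal Z$, let $z_1,\dots,z_n,z_{test}$ be random elements of $\mathcal Z$ with law $\mu$, let $\mathbf e_1,\dots,\mathbf e_n,\mathbf e_{test}$ be identically distributed random vectors in $\mathbb R^p$ whose coordinates are independent with mean $0$ and variance $1$, and let $\epsilon_1,\dots,\epsilon_n$ be identically distributed real random variables with mean $0$ and finite variance $\sigma_y^2\ge 0$; the vector of random functions $\boldsymbol\psi=(\psi_1,\dots,\psi_p)$, the $z$'s, the $\mathbf e$'s and the $\epsilon$'s are all mutually independent (the $\psi_j$ need not be independent of each other). Let $\sigma_x\ge 0$, $\gamma\ge 0$ and put $$\mathbf x_i=\boldsymbol\psi(z_i)+\sigma_x\mathbf e_i,\quad \mathbf x_{test}=\boldsymbol\psi(z_{test})+\sigma_x\mathbf e_{test},\quad y_i=g(z_i)+\epsilon_i,$$ $\mathbf X=[\mathbf x_1|\cdots|\mathbf x_n]^\top$, $\mathbf E=[\mathbf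 e_1|\cdots|\mathbf e_n]^\top$, $\mathbf y=(y_i)_i$, $\boldsymbol\epsilon=(\epsilon_i)_i$, and $$\mathbf A:=p^{-1}\mathbf X\mathbf X^\top+n\gamma\mathbf I_n,\qquad \hat\beta(\mathbf y):=p^{-1/2}\mathbf X^\top\mathbf A^{-1}\mathbf y,$$ where the inverse of a singular matrix (possible if $\gamma=0$) is read as $0$. **Assumptions.** Each $\psi_j$ is pointwise square integrable and mean-square continuous. Let $\lambda_1\ge\lambda_2\ge\dots\ge 0$ be the eigenvalues (with multiplicity, padded by zeros if finitely many are positive) of the integral operator on $L_2(\mu)$ of the continuous kernel $p^{-1}\mathbb E\langle\boldsymbol\psi(z),\boldsymbol\psi(z')\rangle$, and let $u_k$ be corresponding $L_2(\mu)$-orthonormal eigenfunctions, continuous when $\lambda_k>0$. Assume $\sum_k k\lambda_k<\infty$. Put $\phi(z)=(\lambda_k^{1/2}u_k(z))_{k\ge1}$, and assume $g(z)=\phi(z)^\top\theta^*$ for all $z$, for some $\theta^*\in\ell_2$ with $\theta^*_k=0$ whenever $\lambda_k=0$. Write $\boldsymbol\Phi=[\phi(z_1)|\cdots|\phi(z_n)]^\top$,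 $\mathbf K=\boldsymbol\Phi\boldsymbol\Phi^\top$, $\boldsymbol\Lambda=\mathrm{diag}(\lambda_1,\lambda_2,\dots)$, $\|v\|^2_{\boldsymbol\Lambda}=\sum_k\lambda_kv_k^2$, let $\mathbf W$ be the matrix with $p$ rows and infinitely many columns with $\mathbf W_{jk}=(\lambda_kp)^{-1/2}\int\psi_ju_k\,d\mu$ if $\lambda_k>0$ and $\mathbf W_{jk}=0$ otherwise, let $\mathbf I$ be the infinite identity matrix, and put $$\hat\theta(\tilde{\mathbf y}):=\boldsymbol\Phi^\top\mathbf A^{-1}\tilde{\mathbf y},\qquad \boldsymbol\Delta:=\boldsymbol\Phi(\mathbf W^\top\mathbf W-\mathbf I)\boldsymbol\Phi^\top+p^{-1/2}\sigma_x(\boldsymbol\Phi\mathbf W^\top\mathbf E^\top+\mathbf E\mathbf W\boldsymbol\Phi^\top)+p^{-1}\sigma_x^2(\mathbf E\mathbf E^\top-p\mathbf I_n).$$ $\mathbb E_T[\cdot]$ denotes the conditional expectation given everything (random functions, $z_i,z_{test},\mathbf e_i,\mathbf e_{test},\boldsymbol\epsilon$) except the variables $T$. Infinite sums are limits of partial sums.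 **Lemma.** $\phi(z)\in\ell_2$ for every $z$, and almost surely the infinite sums in $\boldsymbol\Phi\mathbf W^\top$ and $\mathbf W\phi(z_{test})$ converge. Moreover: 1. $p^{-1/2}\mathbf x_{test}^\top\hat\beta(\mathbf y)-g(z_{test})=\phi(z_{test})^\top\hat\theta(\mathbf y)-\phi(z_{test})^\top\theta^*+\left(p^{-1}\mathbf x_{test}^\top\mathbf X^\top-\phi(z_{test})^\top\boldsymbol\Phi^\top\right)\mathbf A^{-1}\mathbf y$. 2. Almost surely, $\mathbf A=\mathbf K+(\sigma_x^2+n\gamma)\mathbf I_n+\boldsymbol\Delta$. 3. Almost surely, $$\tfrac14\,\mathbb E_{z_{test},\mathbf e_{test},\boldsymbol\epsilon}\left[\left|p^{-1/2}\mathbf x_{test}^\top\hat\beta(\mathbf y)-g(z_{test})\right|^2\right]\le B+V+S_1+S_2+S_3<\infty,$$ where $B=\|\hat\theta(\boldsymbol\Phi\theta^*)-\theta^*\|^2_{\boldsymbol\Lambda}$, $V=\mathbb E_{\boldsymbol\epsilon}[\|\hat\theta(\boldsymbol\epsilon)\|^2_{\boldsymbol\Lambda}]$, $S_1=\mathbb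 E_{z_{test},\boldsymbol\epsilon}[|\phi(z_{test})^\top(\mathbf W^\top\mathbf W-\mathbf I)\hat\theta(\mathbf y)|^2]$, $S_2=\frac{\sigma_x^2}{p}\mathbb E_{z_{test},\boldsymbol\epsilon}[|\phi(z_{test})^\top\mathbf W^\top\mathbf E^\top\mathbf A^{-1}\mathbf y|^2]$, $S_3=\frac{\sigma_x^2}{p^2}\mathbb E_{\mathbf e_{test},\boldsymbol\epsilon}[|\mathbf e_{test}^\top\mathbf X^\top\mathbf A^{-1}\mathbf y|^2]$. -/

import Mathlib

open MeasureTheory ProbabilityTheory Filter Topology Matrix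
open scoped ENNReal

/-! ### Infinite sums and products of matrices with infinitely many columns

All infinite sums of reals are limits of the partial sums `∑ k < r` as `r → ∞` (the sums in
`Φ Wᵀ` need not converge absolutely). Indices start at `0` instead of `1`. -/

/-- The partial sums `∑ k < r, v k * w k` converge. -/
def DotConverges (v w : ℕ → ℝ) : Prop :=
  ∃ s : ℝ, Tendsto (fun r : ℕ => ∑ k ∈ Finset.range r, v k * w k) atTop (𝓝 s)

/-- `vᵀ w = lim_r ∑ k < r, v k * w k`. -/
noncomputable def seqDot (v w : ℕ → ℝ) : ℝ :=
  limUnder atTop (fun r : ℕ => ∑ k ∈ Finset.range r, v k * w k)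

/-- The row vector `vᵀ M`, for a matrix `M` with infinitely many rows. -/
noncomputable def seqVecMul {β : Type*} (v : ℕ → ℝ) (M : Matrix ℕ β ℝ) : β → ℝ :=
  fun b => seqDot v (fun k => M k b)

/-- The product `M N`, for infinitely many columns of `M` and rows of `N`. -/
noncomputable def seqMul {α β : Type*} (M : Matrix α ℕ ℝ) (N : Matrix ℕ β ℝ) : Matrix α β ℝ :=
  Matrix.of fun a b => seqDot (M a) (fun k => N k b)

/-- `‖v‖²_Λ = ∑ k, λ_k v_k²`, a sum of nonnegative terms with value in `[0, ∞]`. -/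
noncomputable def lamNormSq (lam : ℕ → ℝ) (v : ℕ → ℝ) : ℝ≥0∞ :=
  ∑' k, ENNReal.ofReal (lam k * v k ^ 2)

/-! ### The latent metric model -/

/-- The independent sources of randomness: the random functions, the latent positions, the
coordinates of the covariate noise vectors, the response noise. -/
inductive Source (n p : ℕ) : Type
  | psi : Source n p
  | z (i : Fin n) : Source n p
  | zTest : Source n p
  | e (i : Fin n) (j : Fin p) : Source n p
  | eTest (j : Fin p) : Source n p
  | eps (i : Fin n) : Source n p

/-- The random variables of the model (training and test data), before any law is prescribed.
The random functions are `ψ j (ξ ω) : Z → ℝ`, where `ξ` is the random element of a measurable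
space `Ξ` that carries their randomness. -/
structure LatentData (Ω Ξ Z : Type*) (n p : ℕ) where
  ξ : Ω → Ξ
  ψ : Fin p → Ξ → Z → ℝ
  z : Fin n → Ω → Z
  zTest : Ω → Z
  e : Fin n → Fin p → Ω → ℝ
  eTest : Fin p → Ω → ℝ
  eps : Fin n → Ω → ℝ
  σx : ℝ
  σy : ℝ

namespace LatentData

variable {Ω Ξ Z : Type*} {n p : ℕ}

/-- The σ-algebra generated by one source of randomness. -/
@[reducible] def sigma [MeasurableSpace Ξ] [MeasurableSpace Z] (D : LatentData Ω Ξ Z n p) :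
    Source n p → MeasurableSpace Ω
  | .psi => MeasurableSpace.comap D.ξ inferInstance
  | .z i => MeasurableSpace.comap (D.z i) inferInstance
  | .zTest => MeasurableSpace.comap D.zTest inferInstance
  | .e i j => MeasurableSpace.comap (D.e i j) inferInstance
  | .eTest j => MeasurableSpace.comap (D.eTest j) inferInstance
  | .eps i => MeasurableSpace.comap (D.eps i) inferInstance

/-- The laws of the latent metric model and of the response noise. -/
structure IsLatentMetricModel [MeasurableSpace Ω] [MeasurableSpace Ξ] [MeasurableSpace Z]
    (D : LatentData Ω Ξ Z n p) (P : Measure Ω) (μ : Measure Z) : Prop where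
  measurable_ξ : Measurable D.ξ
  measurable_ψ : ∀ j, Measurable (fun q : Ξ × Z => D.ψ j q.1 q.2)
  measurable_z : ∀ i, Measurable (D.z i)
  measurable_zTest : Measurable D.zTest
  measurable_e : ∀ i j, Measurable (D.e i j)
  measurable_eTest : ∀ j, Measurable (D.eTest j)
  measurable_eps : ∀ i, Measurable (D.eps i)
  /-- all sources of randomness are mutually independent -/
  indep : iIndep D.sigma P
  law_z : ∀ i, P.map (D.z i) = μ
  law_zTest : P.map D.zTest = μ
  /-- the noise vectors, including the test one, have the same law -/
  identDistrib_e : ∀ i j, IdentDistrib (D.e i j) (D.eTest j) P P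
  memLp_eTest : ∀ j, MemLp (D.eTest j) 2 P
  mean_eTest : ∀ j, ∫ ω, D.eTest j ω ∂P = 0
  variance_eTest : ∀ j, ∫ ω, D.eTest j ω ^ 2 ∂P = 1
  identDistrib_eps : ∀ i i', IdentDistrib (D.eps i) (D.eps i') P P
  memLp_eps : ∀ i, MemLp (D.eps i) 2 P
  mean_eps : ∀ i, ∫ ω, D.eps i ω ∂P = 0
  variance_eps : ∀ i, ∫ ω, D.eps i ω ^ 2 ∂P = D.σy ^ 2
  σx_nonneg : 0 ≤ D.σx
  σy_nonneg : 0 ≤ D.σy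

/-- Pointwise square integrability and mean-square continuity of the random functions. -/
structure IsMeanSquareContinuous [MeasurableSpace Ω] [TopologicalSpace Z]
    (D : LatentData Ω Ξ Z n p) (P : Measure Ω) : Prop where
  memLp : ∀ j z, MemLp (fun ω => D.ψ j (D.ξ ω) z) 2 P
  continuous : ∀ j z, Tendsto
    (fun z' => ∫ ω, |D.ψ j (D.ξ ω) z - D.ψ j (D.ξ ω) z'| ^ 2 ∂P) (𝓝 z) (𝓝 0)

/-- The implicit kernel `(z, z') ↦ p⁻¹ 𝔼 ⟨ψ(z), ψ(z')⟩`. -/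
noncomputable def kernel [MeasurableSpace Ω] (D : LatentData Ω Ξ Z n p) (P : Measure Ω)
    (z z' : Z) : ℝ :=
  (p : ℝ)⁻¹ * ∫ ω, ∑ j, D.ψ j (D.ξ ω) z * D.ψ j (D.ξ ω) z' ∂P

/-- Expectation of a `[0, ∞]`-valued random variable over the sources in `T`: the conditional
expectation given every source of randomness except those in `T`. -/
noncomputable def expectOver [MeasurableSpace Ω] [MeasurableSpace Ξ] [MeasurableSpace Z]
    (D : LatentData Ω Ξ Z n p) (P : Measure Ω) (T : Set (Source n p)) (X : Ω → ℝ≥0∞) :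
    Ω → ℝ≥0∞ :=
  condLExp (⨆ s ∈ Tᶜ, D.sigma s) P X

end LatentData

/-- The sources that make up `z_test`. -/
def srcZTest (n p : ℕ) : Set (Source n p) := {Source.zTest}

/-- The sources that make up the vector `e_test`. -/
def srcETest (n p : ℕ) : Set (Source n p) := Set.range Source.eTest

/-- The sources that make up the vector `ε`. -/
def srcEps (n p : ℕ) : Set (Source n p) := Set.range Source.eps

/-! ### Eigensystem and feature map -/

/-- `lam` lists the eigenvalues of the integral operator of `κ` on `L²(μ)` in nonincreasing order
and with multiplicity, padded by zeros if there are finitely many positive ones, and the `u k`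
with `lam k > 0` are orthonormal eigenfunctions, each represented by the function for which the
eigenvalue equation holds at every point (the continuous representative, if `κ` is continuous and
`μ` is finite). By `complete`, what is orthogonal to them lies in the null space of the operator.
The `u k` with `lam k = 0` are irrelevant to the feature map and not restricted. -/
structure IsEigensystem {Z : Type*} [MeasurableSpace Z] (μ : Measure Z) (κ : Z → Z → ℝ)
    (lam : ℕ → ℝ) (u : ℕ → Z → ℝ) : Prop where
  nonneg : ∀ k, 0 ≤ lam k
  antitone : Antitone lam
  memLp : ∀ k, 0 < lam k → MemLp (u k) 2 μ
  orthonormal : ∀ k l, 0 < lam k → 0 < lam l →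
    ∫ z, u k z * u l z ∂μ = if k = l then 1 else 0
  eigen : ∀ k, 0 < lam k → ∀ z, ∫ z', κ z z' * u k z' ∂μ = lam k * u k z
  complete : ∀ h : Z → ℝ, MemLp h 2 μ → (∀ k, 0 < lam k → ∫ z, h z * u k z ∂μ = 0) →
    ∀ᵐ z ∂μ, ∫ z', κ z z' * h z' ∂μ = 0

/-- The feature map `φ(z) = (λ_k^{1/2} u_k(z))_k`. -/
noncomputable def featureMap {Z : Type*} (lam : ℕ → ℝ) (u : ℕ → Z → ℝ) (z : Z) : ℕ → ℝ :=
  fun k => √(lam k) * u k z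

/-! ### The matrices, the estimators and the terms of the bound -/

namespace LatentData

variable {Ω Ξ Z : Type*} {n p : ℕ} (D : LatentData Ω Ξ Z n p)

/-- The `n × p` matrix `E` of covariate noise. -/
def E (ω : Ω) : Matrix (Fin n) (Fin p) ℝ := Matrix.of fun i j => D.e i j ω

/-- The `n × p` matrix `X` with rows `x_i = ψ(z_i) + σ_x e_i`. -/
def X (ω : Ω) : Matrix (Fin n) (Fin p) ℝ :=
  Matrix.of fun i j => D.ψ j (D.ξ ω) (D.z i ω) + D.σx * D.e i j ω

/-- `x_test = ψ(z_test) + σ_x e_test`. -/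
def xTest (ω : Ω) : Fin p → ℝ := fun j => D.ψ j (D.ξ ω) (D.zTest ω) + D.σx * D.eTest j ω

/-- The vector `ε`. -/
def epsVec (ω : Ω) : Fin n → ℝ := fun i => D.eps i ω

/-- The responses `y_i = g(z_i) + ε_i`. -/
def y (g : Z → ℝ) (ω : Ω) : Fin n → ℝ := fun i => g (D.z i ω) + D.eps i ω

/-- `A = p⁻¹ X Xᵀ + n γ I`. -/
noncomputable def A (γ : ℝ) (ω : Ω) : Matrix (Fin n) (Fin n) ℝ :=
  (p : ℝ)⁻¹ • (D.X ω * (D.X ω)ᵀ) + ((n : ℝ) * γ) • (1 : Matrix (Fin n) (Fin n) ℝ)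

/-- `β̂(y) = p^{-1/2} Xᵀ (p⁻¹ X Xᵀ + n γ I)⁻¹ y` (where the inverse of a singular matrix is `0`). -/
noncomputable def betaHat (γ : ℝ) (ω : Ω) (y : Fin n → ℝ) : Fin p → ℝ :=
  (√(p : ℝ))⁻¹ • ((D.X ω)ᵀ *ᵥ
    (((p : ℝ)⁻¹ • (D.X ω * (D.X ω)ᵀ) + ((n : ℝ) * γ) • (1 : Matrix (Fin n) (Fin n) ℝ))⁻¹ *ᵥ y))

/-- The prediction error `p^{-1/2} x_testᵀ β̂(y) - g(z_test)`. -/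
noncomputable def predError (γ : ℝ) (g : Z → ℝ) (ω : Ω) : ℝ :=
  (√(p : ℝ))⁻¹ * (D.xTest ω ⬝ᵥ D.betaHat γ ω (D.y g ω)) - g (D.zTest ω)

variable (lam : ℕ → ℝ) (u : ℕ → Z → ℝ)

/-- `Φ`, with rows `φ(z_i)`. -/
noncomputable def Φ (ω : Ω) : Matrix (Fin n) ℕ ℝ :=
  Matrix.of fun i k => featureMap lam u (D.z i ω) k

/-- `φ(z_test)`. -/
noncomputable def φTest (ω : Ω) : ℕ → ℝ := featureMap lam u (D.zTest ω)

/-- `K = Φ Φᵀ`. -/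
noncomputable def K (ω : Ω) : Matrix (Fin n) (Fin n) ℝ := seqMul (D.Φ lam u ω) (D.Φ lam u ω)ᵀ

/-- `W_{jk} = (λ_k p)^{-1/2} ∫ ψ_j u_k dμ` if `λ_k ≠ 0`, and `W_{jk} = 0` otherwise. -/
noncomputable def W [MeasurableSpace Z] (μ : Measure Z) (ω : Ω) : Matrix (Fin p) ℕ ℝ :=
  Matrix.of fun j k =>
    if lam k = 0 then 0 else (√(lam k * (p : ℝ)))⁻¹ * ∫ z, D.ψ j (D.ξ ω) z * u k z ∂μ

/-- The infinite matrix `Wᵀ W - I`. -/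
noncomputable def WtWsubI [MeasurableSpace Z] (μ : Measure Z) (ω : Ω) : Matrix ℕ ℕ ℝ :=
  (D.W lam u μ ω)ᵀ * D.W lam u μ ω - 1

/-- The perturbation matrix
`Δ = Φ (Wᵀ W - I) Φᵀ + p^{-1/2} σ_x (Φ Wᵀ Eᵀ + E W Φᵀ) + p⁻¹ σ_x² (E Eᵀ - p I)`. -/
noncomputable def Δ [MeasurableSpace Z] (μ : Measure Z) (ω : Ω) : Matrix (Fin n) (Fin n) ℝ :=
  seqMul (seqMul (D.Φ lam u ω) (D.WtWsubI lam u μ ω)) (D.Φ lam u ω)ᵀ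
  + ((√(p : ℝ))⁻¹ * D.σx) •
      (seqMul (D.Φ lam u ω) (D.W lam u μ ω)ᵀ * (D.E ω)ᵀ
        + D.E ω * seqMul (D.W lam u μ ω) (D.Φ lam u ω)ᵀ)
  + ((p : ℝ)⁻¹ * D.σx ^ 2) • (D.E ω * (D.E ω)ᵀ - (p : ℝ) • (1 : Matrix (Fin n) (Fin n) ℝ))

/-- `θ̂(y) = Φᵀ A⁻¹ y`. -/
noncomputable def thetaHat (γ : ℝ) (ω : Ω) (y : Fin n → ℝ) : ℕ → ℝ :=
  (D.Φ lam u ω)ᵀ *ᵥ ((D.A γ ω)⁻¹ *ᵥ y)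

/-- `B = ‖θ̂(Φ θ) - θ‖²_Λ`. -/
noncomputable def B (γ : ℝ) (θ : ℕ → ℝ) (ω : Ω) : ℝ≥0∞ :=
  lamNormSq lam (D.thetaHat lam u γ ω (fun i => seqDot (D.Φ lam u ω i) θ) - θ)

section Probability

variable [MeasurableSpace Ω] [MeasurableSpace Ξ] [MeasurableSpace Z]
  (P : Measure Ω) (μ : Measure Z)

/-- The excess risk `𝔼_{z_test, e_test, ε} |p^{-1/2} x_testᵀ β̂(y) - g(z_test)|²`. -/
noncomputable def excessRisk (γ : ℝ) (g : Z → ℝ) : Ω → ℝ≥0∞ :=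
  D.expectOver P (srcZTest n p ∪ srcETest n p ∪ srcEps n p)
    (fun ω => ENNReal.ofReal (|D.predError γ g ω| ^ 2))

/-- `V = 𝔼_ε ‖θ̂(ε)‖²_Λ`. -/
noncomputable def V (γ : ℝ) : Ω → ℝ≥0∞ :=
  D.expectOver P (srcEps n p) (fun ω => lamNormSq lam (D.thetaHat lam u γ ω (D.epsVec ω)))

/-- `S₁ = 𝔼_{z_test, ε} |φ(z_test)ᵀ (Wᵀ W - I) θ̂(y)|²`. -/
noncomputable def S₁ (γ : ℝ) (g : Z → ℝ) : Ω → ℝ≥0∞ :=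
  D.expectOver P (srcZTest n p ∪ srcEps n p) (fun ω => ENNReal.ofReal
    (|seqDot (seqVecMul (D.φTest lam u ω) (D.WtWsubI lam u μ ω))
        (D.thetaHat lam u γ ω (D.y g ω))| ^ 2))

/-- `S₂ = (σ_x² / p) 𝔼_{z_test, ε} |φ(z_test)ᵀ Wᵀ Eᵀ A⁻¹ y|²`. -/
noncomputable def S₂ (γ : ℝ) (g : Z → ℝ) (ω : Ω) : ℝ≥0∞ :=
  ENNReal.ofReal (D.σx ^ 2 / (p : ℝ)) *
    D.expectOver P (srcZTest n p ∪ srcEps n p) (fun ω => ENNReal.ofReal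
      (|seqVecMul (D.φTest lam u ω) (D.W lam u μ ω)ᵀ ⬝ᵥ
          ((D.E ω)ᵀ *ᵥ ((D.A γ ω)⁻¹ *ᵥ D.y g ω))| ^ 2)) ω

/-- `S₃ = (σ_x² / p²) 𝔼_{e_test, ε} |e_testᵀ Xᵀ A⁻¹ y|²`. -/
noncomputable def S₃ (γ : ℝ) (g : Z → ℝ) (ω : Ω) : ℝ≥0∞ :=
  ENNReal.ofReal (D.σx ^ 2 / (p : ℝ) ^ 2) *
    D.expectOver P (srcETest n p ∪ srcEps n p) (fun ω => ENNReal.ofReal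
      (|(fun j => D.eTest j ω) ⬝ᵥ ((D.X ω)ᵀ *ᵥ ((D.A γ ω)⁻¹ *ᵥ D.y g ω))| ^ 2)) ω

end Probability

end LatentData

/-! ### Square integrable functions -/

/-! The core is a Karhunen-Loève expansion of the random functions that converges almost everywhere.
By Fubini and the eigenvalue equation, the coefficients `∫ ψ_j u_k dμ`, summed over `j`, are
uncorrelated with total second moment `p λ_k`. Hence `∑ k λ_k < ∞` makes the `k`-weighted sum of
their squares almost surely finite. This rate forces pointwise convergence: along `r = 2^m` the
squared `L²` errors are summable, and between powers of two Cauchy-Schwarz controls the partial sums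
(`tendsto_of_tendsto_two_pow`, `ae_tendsto_expansion`). The limit is `ψ_j` itself, since almost
surely `ψ_j` is orthogonal to everything orthogonal to the eigenfunctions (`ae_inner_eq_zero`). The
positions are independent of the random functions, so the expansion holds at `z_i` and `z_test`
(`ae_hasExpansions`), that is, `Φ Wᵀ` has entries `p^{-1/2} ψ_j(z_i)`. Columns of `W` with `λ_k > 0`
have expected squared norm 1, so square summability of the rows cannot replace this argument.

The rest of the decomposition is algebra. Expanding `X Xᵀ` gives `A_eq`, and expanding `x_testᵀ x_i`
splits the prediction error into a ridge error and three perturbation errors (`predError_eq_sum`);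
squaring four terms costs the factor 4. The infinite sums of features are controlled by a Bessel
inequality that bounds `∑ φ_k(z)²` uniformly in `z` (`sum_lam_mul_posEigen_sq_le`).

Conditional expectations become integrals over independent copies of some sources
(`expectOver_ae_eq`). In the ridge error, the coefficient vector is a deterministic bias plus the
centered `θ̂(ε)`, which is independent of `z_test`. Orthogonality of the features bounds the second
moments of partial sums by `B + V`, and Fatou passes to the limit (`lintegral_ridgeError_le`). The
perturbation terms are finite because each error is a finite sum of products of independent square
integrable variables (`memLp_sum_mul_of_indepFun`). -/

lemma inner_toLp_eq_integral {α : Type*} [MeasurableSpace α] {μ : Measure α} {f g : α → ℝ}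
    (hf : MemLp f 2 μ) (hg : MemLp g 2 μ) :
    inner ℝ (hf.toLp f) (hg.toLp g) = ∫ a, f a * g a ∂μ := by
  rw [MeasureTheory.L2.inner_def]
  refine integral_congr_ae ?_
  filter_upwards [hf.coeFn_toLp, hg.coeFn_toLp] with a h1 h2
  simp [h1, h2, mul_comm]

lemma sq_integral_mul_le {α : Type*} [MeasurableSpace α] {μ : Measure α} {f g : α → ℝ}
    (hf : MemLp f 2 μ) (hg : MemLp g 2 μ) :
    (∫ a, f a * g a ∂μ) ^ 2 ≤ (∫ a, f a ^ 2 ∂μ) * ∫ a, g a ^ 2 ∂μ := by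
  have := real_inner_mul_inner_self_le (hf.toLp f) (hg.toLp g)
  rw [inner_toLp_eq_integral, inner_toLp_eq_integral, inner_toLp_eq_integral] at this
  simpa only [pow_two] using this

/-! ### Partial sums of orthogonal expansions -/

/-- Let `N` be the largest power of two not exceeding `r`. The block from `N` to `r` has at most `N`
terms, all with index at least `N`, so the factor lost in Cauchy-Schwarz is absorbed by the weight
`k + 1` and a tail of the convergent series remains. -/
lemma tendsto_of_tendsto_two_pow {a : ℕ → ℝ} {s : ℝ}
    (ha : Summable fun k : ℕ => ((k : ℝ) + 1) * a k ^ 2)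
    (hs : Tendsto (fun m : ℕ => ∑ k ∈ Finset.range (2 ^ m), a k) atTop (𝓝 s)) :
    Tendsto (fun r : ℕ => ∑ k ∈ Finset.range r, a k) atTop (𝓝 s) := by
  have hlog : Tendsto (fun r : ℕ => Nat.log 2 r) atTop atTop := by
    refine tendsto_atTop.2 fun b => ?_
    filter_upwards [eventually_ge_atTop (2 ^ b)] with r hr
    exact Nat.le_log_of_pow_le (by norm_num) hr
  have hpow : Tendsto (fun r : ℕ => 2 ^ Nat.log 2 r) atTop atTop :=
    (tendsto_pow_atTop_atTop_of_one_lt (by norm_num)).comp hlog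
  have htail := (tendsto_sum_nat_add fun k : ℕ => ((k : ℝ) + 1) * a k ^ 2).comp hpow
  have hsq : Tendsto (fun r : ℕ => (∑ k ∈ Finset.range r, a k
      - ∑ k ∈ Finset.range (2 ^ Nat.log 2 r), a k) ^ 2) atTop (𝓝 0) := by
    refine tendsto_of_tendsto_of_tendsto_of_le_of_le' tendsto_const_nhds htail
      (Eventually.of_forall fun r => sq_nonneg _) ?_
    filter_upwards [eventually_ge_atTop 1] with r hr
    have h1 : 2 ^ Nat.log 2 r ≤ r := Nat.pow_log_le_self 2 (by omega)
    have h2 : r < 2 ^ Nat.log 2 r * 2 := by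
      have := Nat.lt_pow_succ_log_self (b := 2) (by norm_num) r
      rwa [pow_succ] at this
    set N := 2 ^ Nat.log 2 r
    have e1 : ∑ k ∈ Finset.range r, a k - ∑ k ∈ Finset.range N, a k
        = ∑ i ∈ Finset.range (r - N), a (i + N) := by
      conv_lhs => rw [show r = N + (r - N) by omega, Finset.sum_range_add]
      simp [add_comm]
    have hNr : ((r - N : ℕ) : ℝ) ≤ N := by exact_mod_cast (by omega : r - N ≤ N)
    rw [e1]
    calc (∑ i ∈ Finset.range (r - N), a (i + N)) ^ 2
        ≤ (r - N : ℕ) * ∑ i ∈ Finset.range (r - N), a (i + N) ^ 2 := by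
          simpa using sq_sum_le_card_mul_sum_sq (s := Finset.range (r - N))
            (f := fun i => a (i + N))
      _ = ∑ i ∈ Finset.range (r - N), ((r - N : ℕ) : ℝ) * a (i + N) ^ 2 := by
          rw [Finset.mul_sum]
      _ ≤ ∑ i ∈ Finset.range (r - N), (((i + N : ℕ) : ℝ) + 1) * a (i + N) ^ 2 := by
          refine Finset.sum_le_sum fun i _ => mul_le_mul_of_nonneg_right ?_ (sq_nonneg _)
          push_cast
          have : (0 : ℝ) ≤ i := Nat.cast_nonneg i
          linarith
      _ ≤ _ := ((summable_nat_add_iff N).2 ha).sum_le_tsum _ fun i _ => by positivity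
  have hdiff : Tendsto (fun r : ℕ => ∑ k ∈ Finset.range r, a k
      - ∑ k ∈ Finset.range (2 ^ Nat.log 2 r), a k) atTop (𝓝 0) := by
    refine (tendsto_zero_iff_abs_tendsto_zero _).2 ?_
    have := hsq.sqrt
    simpa [Real.sqrt_sq_eq_abs, Function.comp_def] using this
  simpa using hdiff.add (hs.comp hlog)

/-- For an orthogonal sequence of vectors of norm `0` or `1`, the expansion of a vector that is
orthogonal to their orthogonal complement converges at a rate given by a weighted square sum of
its coefficients. -/
lemma norm_sub_partialSum_sq_le {H : Type*} [NormedAddCommGroup H] [InnerProductSpace ℝ H]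
    [CompleteSpace H] {v : ℕ → H} {pos : ℕ → Prop} [DecidablePred pos]
    (hv : ∀ k l, inner ℝ (v k) (v l) = if k = l ∧ pos k then (1 : ℝ) else 0) (f : H)
    (hf : ∀ h : H, (∀ k, inner ℝ h (v k) = 0) → inner ℝ f h = 0)
    (hsum : Summable fun k : ℕ => ((k : ℝ) + 1) * (inner ℝ f (v k)) ^ 2) (r : ℕ) :
    ‖f - ∑ k ∈ Finset.range r, (inner ℝ f (v k) : ℝ) • v k‖ ^ 2
      ≤ (∑' k : ℕ, ((k : ℝ) + 1) * (inner ℝ f (v k)) ^ 2) / (r + 1) := by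
  set c : ℕ → ℝ := fun k => inner ℝ f (v k) with hc
  set Q := ∑' k : ℕ, ((k : ℝ) + 1) * c k ^ 2 with hQ
  set S : ℕ → H := fun r => ∑ k ∈ Finset.range r, c k • v k with hS
  have hQ0 : 0 ≤ Q := tsum_nonneg fun k => by positivity
  have hv0 : ∀ k, ¬ pos k → v k = 0 := fun k hk => by
    have := hv k k
    simpa [hk] using this
  have hc0 : ∀ k, ¬ pos k → c k = 0 := fun k hk => by simp [hc, hv0 k hk]
  have hSv : ∀ r k, inner ℝ (S r) (v k) = if k < r then c k else 0 := by
    intro r k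
    simp only [hS, sum_inner, real_inner_smul_left, hv]
    have : ∀ i, c i * (if i = k ∧ pos i then (1 : ℝ) else 0) = if i = k then c k else 0 := by
      intro i
      by_cases hik : i = k
      · subst hik
        by_cases hi : pos i <;> simp [hi, hc0]
      · simp [hik]
    simp [this]
  -- By orthogonality the block has squared norm `∑ c k ^ 2`; on it `k + 1 ≥ r + 1`, which turns the
  -- weight into the rate.
  have hblock : ∀ r R, r ≤ R → ‖S R - S r‖ ^ 2 ≤ Q / (r + 1) := by
    intro r R hrR
    have e : S R - S r = ∑ k ∈ Finset.Ico r R, c k • v k := by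
      rw [hS]; exact (Finset.sum_Ico_eq_sub _ hrR).symm
    have e2 : ‖S R - S r‖ ^ 2 = ∑ k ∈ Finset.Ico r R, c k ^ 2 := by
      rw [← real_inner_self_eq_norm_sq]
      rw [e]
      conv_lhs => rw [inner_sum]
      refine Finset.sum_congr rfl fun k hk => ?_
      rw [← e, real_inner_smul_right, inner_sub_left, hSv, hSv,
        if_pos (Finset.mem_Ico.1 hk).2, if_neg (not_lt.2 (Finset.mem_Ico.1 hk).1)]
      ring
    rw [e2, le_div_iff₀ (by positivity), Finset.sum_mul]
    calc ∑ k ∈ Finset.Ico r R, c k ^ 2 * ((r : ℝ) + 1)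
        ≤ ∑ k ∈ Finset.Ico r R, ((k : ℝ) + 1) * c k ^ 2 := by
          refine Finset.sum_le_sum fun k hk => ?_
          rw [mul_comm]
          have : (r : ℝ) ≤ k := by exact_mod_cast (Finset.mem_Ico.1 hk).1
          gcongr
      _ ≤ Q := hsum.sum_le_tsum _ fun k _ => by positivity
  have hcauchy : CauchySeq S := by
    refine cauchySeq_of_le_tendsto_0' (fun r => √(Q / (r + 1))) ?_ ?_
    · intro r R hrR
      rw [dist_comm, dist_eq_norm]
      exact Real.le_sqrt_of_sq_le (hblock r R hrR)
    · have : Tendsto (fun r : ℕ => Q / ((r : ℝ) + 1)) atTop (𝓝 0) := by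
        have := (tendsto_one_div_add_atTop_nhds_zero_nat (𝕜 := ℝ)).const_mul Q
        simpa [div_eq_mul_inv] using this
      simpa using this.sqrt
  obtain ⟨F, hF⟩ := cauchySeq_tendsto_of_complete hcauchy
  have hFv : ∀ k, inner ℝ F (v k) = c k := by
    intro k
    refine tendsto_nhds_unique (hF.inner tendsto_const_nhds) (tendsto_const_nhds.congr' ?_)
    filter_upwards [eventually_gt_atTop k] with r hr
    rw [hSv, if_pos hr]
  -- `f - F` is orthogonal to every `v k`, hence to `f` by `hf`, and to `F` as a limit of their
  -- combinations; so it vanishes.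
  have hperp : ∀ k, inner ℝ (f - F) (v k) = 0 := fun k => by
    rw [inner_sub_left, hFv]; simp [hc]
  have h1 : inner ℝ f (f - F) = 0 := hf _ hperp
  have h2 : inner ℝ F (f - F) = 0 := by
    refine tendsto_nhds_unique (hF.inner tendsto_const_nhds) (tendsto_const_nhds.congr fun r => ?_)
    simp only [hS, sum_inner, real_inner_smul_left]
    refine (Finset.sum_eq_zero fun k _ => ?_).symm
    rw [real_inner_comm, hperp, mul_zero]
  have hfF : f = F := by
    rw [← sub_eq_zero, ← inner_self_eq_zero (𝕜 := ℝ), inner_sub_left, h1, h2, sub_zero]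
  change ‖f - S r‖ ^ 2 ≤ _
  rw [hfF]
  refine le_of_tendsto ((hF.sub tendsto_const_nhds).norm.pow 2) ?_
  filter_upwards [eventually_ge_atTop r] with R hR using hblock r R hR

/-! ### Second order random functions -/

/-- A jointly measurable random function with second moments bounded by `C`. -/
structure IsSecondOrder {Ω Z : Type*} [MeasurableSpace Ω] [MeasurableSpace Z] (P : Measure Ω)
    (F : Ω → Z → ℝ) (C : ℝ) : Prop where
  measurable : Measurable (Function.uncurry F)
  memLp : ∀ z, MemLp (fun ω => F ω z) 2 P
  le : ∀ z, ∫ ω, F ω z ^ 2 ∂P ≤ C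

lemma MeasureTheory.MemLp.mul_prod {α β : Type*} [MeasurableSpace α] [MeasurableSpace β]
    {μ : Measure α} {ν : Measure β} [SFinite μ] [SFinite ν] {f : α → ℝ} {g : β → ℝ}
    (hf : MemLp f 2 μ) (hg : MemLp g 2 ν) :
    MemLp (fun q : α × β => f q.1 * g q.2) 2 (μ.prod ν) := by
  refine (memLp_two_iff_integrable_sq (hf.1.comp_fst.mul hg.1.comp_snd)).2 ?_
  simpa only [Pi.mul_apply, mul_pow] using hf.integrable_sq.mul_prod hg.integrable_sq

namespace IsSecondOrder

variable {Ω Z : Type*} [MeasurableSpace Ω] [MeasurableSpace Z] {P : Measure Ω}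
  [IsProbabilityMeasure P] {μ : Measure Z} [IsProbabilityMeasure μ] {F : Ω → Z → ℝ} {C : ℝ}

lemma memLp_prod (hF : IsSecondOrder P F C) (μ : Measure Z) [IsProbabilityMeasure μ] :
    MemLp (Function.uncurry F) 2 (P.prod μ) := by
  rw [memLp_two_iff_integrable_sq hF.measurable.aestronglyMeasurable]
  have hm : Measurable fun q : Ω × Z => Function.uncurry F q ^ 2 := hF.measurable.pow_const 2
  refine (integrable_prod_iff' hm.aestronglyMeasurable).2 ⟨?_, ?_⟩
  · exact Eventually.of_forall fun z => (hF.memLp z).integrable_sq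
  · refine Integrable.of_bound (C := C) ?_ (Eventually.of_forall fun z => ?_)
    · exact (hm.norm.stronglyMeasurable.integral_prod_left').aestronglyMeasurable
    · have h0 : 0 ≤ ∫ ω, F ω z ^ 2 ∂P := integral_nonneg fun _ => sq_nonneg _
      simpa [abs_of_nonneg h0] using hF.le z

lemma ae_memLp (hF : IsSecondOrder P F C) (μ : Measure Z) [IsProbabilityMeasure μ] :
    ∀ᵐ ω ∂P, MemLp (F ω) 2 μ := by
  have h := ((hF.memLp_prod μ).integrable_sq).prod_right_ae
  filter_upwards [h] with ω hω
  exact (memLp_two_iff_integrable_sq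
    (hF.measurable.comp measurable_prodMk_left).aestronglyMeasurable).2 hω

/-- Cauchy-Schwarz in `z` bounds the squared coefficient by `∫ F² dμ` times a constant, and this is
integrable over `P`. -/
lemma memLp_coef (hF : IsSecondOrder P F C) {h : Z → ℝ} (hh : MemLp h 2 μ) :
    MemLp (fun ω => ∫ z, F ω z * h z ∂μ) 2 P := by
  have hm : AEStronglyMeasurable (fun ω => ∫ z, F ω z * h z ∂μ) P :=
    (hF.measurable.aestronglyMeasurable.mul hh.1.comp_snd).integral_prod_right'
  rw [memLp_two_iff_integrable_sq hm]
  have hI : Integrable (fun ω => (∫ z, F ω z ^ 2 ∂μ) * ∫ z, h z ^ 2 ∂μ) P :=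
    ((hF.memLp_prod μ).integrable_sq).integral_prod_left.mul_const _
  refine hI.mono' (hm.pow 2) ?_
  filter_upwards [hF.ae_memLp μ] with ω hω
  rw [Real.norm_of_nonneg (sq_nonneg _)]
  exact sq_integral_mul_le hω hh

lemma integral_mul_coef (hF : IsSecondOrder P F C) {h : Z → ℝ} (hh : MemLp h 2 μ) (z : Z) :
    ∫ ω, F ω z * ∫ z', F ω z' * h z' ∂μ ∂P = ∫ z', (∫ ω, F ω z * F ω z' ∂P) * h z' ∂μ := by
  have hI : Integrable (fun q : Ω × Z => F q.1 z * (F q.1 q.2 * h q.2)) (P.prod μ) := by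
    have := (hF.memLp_prod μ).integrable_mul ((hF.memLp z).mul_prod hh)
    refine this.congr (Eventually.of_forall fun q => ?_)
    simp [Function.uncurry]; ring
  simp_rw [← integral_const_mul, ← integral_mul_const]
  rw [integral_integral_swap hI]
  simp_rw [mul_assoc]

lemma integral_coef_mul_coef (hF : IsSecondOrder P F C) {h h' : Z → ℝ} (hh : MemLp h 2 μ)
    (hh' : MemLp h' 2 μ) :
    ∫ ω, (∫ z, F ω z * h z ∂μ) * (∫ z, F ω z * h' z ∂μ) ∂P
      = ∫ z, (∫ ω, F ω z * ∫ z', F ω z' * h z' ∂μ ∂P) * h' z ∂μ := by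
  set a : Ω → ℝ := fun ω => ∫ z, F ω z * h z ∂μ with ha
  have hI : Integrable (fun q : Ω × Z => a q.1 * (F q.1 q.2 * h' q.2)) (P.prod μ) := by
    have := (hF.memLp_prod μ).integrable_mul ((hF.memLp_coef hh).mul_prod hh')
    refine this.congr (Eventually.of_forall fun q => ?_)
    simp [Function.uncurry, ha]; ring
  have e1 : ∀ ω, a ω * ∫ z, F ω z * h' z ∂μ = ∫ z, a ω * (F ω z * h' z) ∂μ :=
    fun ω => (integral_const_mul _ _).symm
  have e2 : ∀ z, (∫ ω, F ω z * a ω ∂P) * h' z = ∫ ω, a ω * (F ω z * h' z) ∂P := fun z => by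
    rw [← integral_mul_const]
    exact integral_congr_ae (Eventually.of_forall fun ω => by ring)
  refine (integral_congr_ae (Eventually.of_forall e1)).trans ?_
  rw [integral_integral_swap hI]
  exact integral_congr_ae (Eventually.of_forall fun z => (e2 z).symm)

lemma integrable_integral_mul_coef_mul (hF : IsSecondOrder P F C) {h h' : Z → ℝ}
    (hh : MemLp h 2 μ) (hh' : MemLp h' 2 μ) :
    Integrable (fun z => (∫ ω, F ω z * ∫ z', F ω z' * h z' ∂μ ∂P) * h' z) μ := by
  have := ((hF.memLp_prod μ).integrable_mul ((hF.memLp_coef hh).mul_prod hh')).integral_prod_right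
  refine this.congr (Eventually.of_forall fun z => ?_)
  refine (integral_congr_ae (Eventually.of_forall fun ω => ?_)).trans (integral_mul_const _ _)
  simp [Function.uncurry]; ring

end IsSecondOrder

/-! ### Auxiliary facts on series of functions -/

/-- By monotone convergence the sum has finite integral, hence is finite almost everywhere. -/
lemma ae_summable_of_integral_le {α : Type*} [MeasurableSpace α] {μ : Measure α}
    {f : ℕ → α → ℝ} {b : ℕ → ℝ} (hf : ∀ k, Integrable (f k) μ) (h0 : ∀ k a, 0 ≤ f k a)
    (hb : ∀ k, ∫ a, f k a ∂μ ≤ b k) (hs : Summable b) :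
    ∀ᵐ a ∂μ, Summable fun k => f k a := by
  have h1 : ∫⁻ a, ∑' k, ENNReal.ofReal (f k a) ∂μ ≠ ∞ := by
    rw [lintegral_tsum fun k => (hf k).1.aemeasurable.ennreal_ofReal]
    refine ne_top_of_le_ne_top hs.tsum_ofReal_ne_top (ENNReal.tsum_le_tsum fun k => ?_)
    rw [← ofReal_integral_eq_lintegral_ofReal (hf k) (Eventually.of_forall (h0 k))]
    exact ENNReal.ofReal_le_ofReal (hb k)
  have h2 := ae_lt_top' (AEMeasurable.tsum
    fun k => (hf k).1.aemeasurable.ennreal_ofReal) h1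
  filter_upwards [h2] with a ha
  have := ENNReal.summable_toReal ha.ne
  simpa only [ENNReal.toReal_ofReal (h0 _ a)] using this

lemma coeFn_sum_smul_toLp {α : Type*} [MeasurableSpace α] {μ : Measure α} {g : ℕ → α → ℝ}
    (hg : ∀ k, MemLp (g k) 2 μ) (c : ℕ → ℝ) (s : Finset ℕ) :
    ⇑(∑ k ∈ s, c k • (hg k).toLp (g k)) =ᵐ[μ] fun a => ∑ k ∈ s, c k * g k a := by
  induction s using Finset.induction_on with
  | empty => simpa [Pi.zero_def] using Lp.coeFn_zero ℝ 2 μ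
  | insert k s hk ih =>
    rw [Finset.sum_insert hk]
    filter_upwards [ih, Lp.coeFn_add (c k • (hg k).toLp (g k)) (∑ k ∈ s, c k • (hg k).toLp (g k)),
      Lp.coeFn_smul (c k) ((hg k).toLp (g k)), (hg k).coeFn_toLp] with a h1 h2 h3 h4
    rw [h2, Pi.add_apply, h1, h3, Finset.sum_insert hk, Pi.smul_apply, h4, smul_eq_mul]

lemma norm_toLp_sub_sum_sq {α : Type*} [MeasurableSpace α] {μ : Measure α} {f : α → ℝ}
    {g : ℕ → α → ℝ} (hf : MemLp f 2 μ) (hg : ∀ k, MemLp (g k) 2 μ) (c : ℕ → ℝ) (s : Finset ℕ) :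
    ‖hf.toLp f - ∑ k ∈ s, c k • (hg k).toLp (g k)‖ ^ 2
      = ∫ a, (f a - ∑ k ∈ s, c k * g k a) ^ 2 ∂μ := by
  rw [← real_inner_self_eq_norm_sq, MeasureTheory.L2.inner_def]
  refine integral_congr_ae ?_
  filter_upwards [coeFn_sum_smul_toLp hg c s, hf.coeFn_toLp,
    Lp.coeFn_sub (hf.toLp f) (∑ k ∈ s, c k • (hg k).toLp (g k))] with a h1 h2 h3
  rw [h3, Pi.sub_apply, h1, h2]
  simp [pow_two]

/-- This is `‖f - ∑ c k • g k‖² ≥ 0` expanded. The `g k` are not assumed orthogonal: in the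
application orthogonality appears only after a sum over coordinates. -/
lemma bessel_quadratic_nonneg {α : Type*} [MeasurableSpace α] {μ : Measure α} {f : α → ℝ}
    {g : ℕ → α → ℝ} (hf : MemLp f 2 μ) (hg : ∀ k, MemLp (g k) 2 μ) (c : ℕ → ℝ) (s : Finset ℕ) :
    0 ≤ ∫ a, f a ^ 2 ∂μ - 2 * ∑ k ∈ s, c k * ∫ a, f a * g k a ∂μ
      + ∑ k ∈ s, ∑ l ∈ s, c k * c l * ∫ a, g l a * g k a ∂μ := by
  have h := sq_nonneg ‖hf.toLp f - ∑ k ∈ s, c k • (hg k).toLp (g k)‖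
  rw [norm_sub_sq_real, ← real_inner_self_eq_norm_sq, ← real_inner_self_eq_norm_sq,
    inner_toLp_eq_integral] at h
  simp only [inner_sum, sum_inner, real_inner_smul_left, real_inner_smul_right,
    inner_toLp_eq_integral] at h
  simpa only [pow_two, mul_assoc] using h

/-- An `L²` function that is orthogonal to the orthogonal complement of an orthonormal family is
almost everywhere the limit of its expansion if its coefficients decay fast enough. -/
lemma ae_tendsto_expansion {α : Type*} [MeasurableSpace α] {μ : Measure α} {f : α → ℝ}
    {g : ℕ → α → ℝ} (hf : MemLp f 2 μ) (hg : ∀ k, MemLp (g k) 2 μ) {pos : ℕ → Prop}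
    (horth : ∀ k l, ∫ a, g k a * g l a ∂μ
      = open Classical in if k = l ∧ pos k then (1 : ℝ) else 0)
    (hperp : ∀ h : Lp ℝ 2 μ, (∀ k, inner ℝ h ((hg k).toLp (g k)) = 0) →
      inner ℝ (hf.toLp f) h = 0)
    (hsum : Summable fun k : ℕ => ((k : ℝ) + 1) * (∫ a, f a * g k a ∂μ) ^ 2) :
    ∀ᵐ a ∂μ, Tendsto (fun r : ℕ => ∑ k ∈ Finset.range r, (∫ a, f a * g k a ∂μ) * g k a)
      atTop (𝓝 (f a)) := by
  classical
  set c : ℕ → ℝ := fun k => ∫ a, f a * g k a ∂μ with hc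
  have hin : ∀ k, inner ℝ (hf.toLp f) ((hg k).toLp (g k)) = c k :=
    fun k => inner_toLp_eq_integral hf (hg k)
  have hL2 : ∀ r : ℕ, ∫ a, (f a - ∑ k ∈ Finset.range r, c k * g k a) ^ 2 ∂μ
      ≤ (∑' k : ℕ, ((k : ℝ) + 1) * c k ^ 2) / (r + 1) := by
    intro r
    have := norm_sub_partialSum_sq_le (v := fun k => (hg k).toLp (g k)) (pos := pos)
      (fun k l => by rw [inner_toLp_eq_integral, horth]) (hf.toLp f) hperp
      (by simpa only [hin] using hsum) r
    simp only [hin] at this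
    rwa [norm_toLp_sub_sum_sq] at this
  set Q := ∑' k : ℕ, ((k : ℝ) + 1) * c k ^ 2
  have hQ : 0 ≤ Q := tsum_nonneg fun k => by positivity
  have hS : ∀ r : ℕ, MemLp (fun a => f a - ∑ k ∈ Finset.range r, c k * g k a) 2 μ :=
    fun r => hf.sub (memLp_finsetSum _ fun k _ => (hg k).const_mul (c k))
  -- Along `r = 2 ^ m` the squared `L²` errors are at most `Q * 2 ^ (-m)`, which is summable, so the
  -- errors tend to `0` almost everywhere.
  have h1 : ∀ᵐ a ∂μ, Summable fun m : ℕ =>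
      (f a - ∑ k ∈ Finset.range (2 ^ m), c k * g k a) ^ 2 := by
    refine ae_summable_of_integral_le (b := fun m => Q * (1 / 2) ^ m)
      (fun m => (hS _).integrable_sq) (fun m a => sq_nonneg _) (fun m => (hL2 _).trans ?_)
      (summable_geometric_two.mul_left Q)
    rw [div_eq_mul_inv]
    refine mul_le_mul_of_nonneg_left ?_ hQ
    rw [one_div, inv_pow]
    gcongr
    push_cast
    linarith
  -- Since `∫ (g k)² ≤ 1`, the weighted square sum of the terms is finite almost everywhere; this
  -- controls the partial sums between powers of two.
  have h2 : ∀ᵐ a ∂μ, Summable fun k : ℕ => ((k : ℝ) + 1) * (c k * g k a) ^ 2 := by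
    refine ae_summable_of_integral_le (b := fun k : ℕ => ((k : ℝ) + 1) * c k ^ 2)
      (fun k => (((hg k).const_mul (c k)).integrable_sq).const_mul _)
      (fun k a => by positivity) (fun k => ?_) hsum
    simp_rw [mul_pow]
    rw [integral_const_mul, integral_const_mul]
    have : ∫ a, g k a ^ 2 ∂μ ≤ 1 := by
      have := horth k k
      simp only [← pow_two] at this
      rw [this]
      split_ifs <;> norm_num
    calc ((k : ℝ) + 1) * (c k ^ 2 * ∫ a, g k a ^ 2 ∂μ)
        ≤ ((k : ℝ) + 1) * (c k ^ 2 * 1) := by gcongr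
      _ = _ := by rw [mul_one]
  filter_upwards [h1, h2] with a ha1 ha2
  refine tendsto_of_tendsto_two_pow ha2 ?_
  have := ha1.tendsto_atTop_zero.sqrt
  simp only [Real.sqrt_sq_eq_abs, Real.sqrt_zero] at this
  have := (tendsto_zero_iff_abs_tendsto_zero _).2 this
  simpa using (tendsto_const_nhds (x := f a)).sub this

/-! ### Expansion of second order random functions in an eigensystem -/

/-- The eigenfunctions of positive eigenvalues, with zero in place of the other ones. -/
noncomputable def posEigen {Z : Type*} (lam : ℕ → ℝ) (u : ℕ → Z → ℝ) (k : ℕ) (z : Z) : ℝ :=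
  if 0 < lam k then u k z else 0

lemma posEigen_of_pos {Z : Type*} {lam : ℕ → ℝ} {u : ℕ → Z → ℝ} {k : ℕ} (hk : 0 < lam k) :
    posEigen lam u k = u k := by
  ext z; simp [posEigen, hk]

lemma posEigen_of_not_pos {Z : Type*} {lam : ℕ → ℝ} {u : ℕ → Z → ℝ} {k : ℕ}
    (hk : ¬ 0 < lam k) : posEigen lam u k = fun _ => 0 := by
  ext z; simp [posEigen, hk]

lemma featureMap_eq_posEigen {Z : Type*} {lam : ℕ → ℝ} {u : ℕ → Z → ℝ} (h0 : ∀ k, 0 ≤ lam k)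
    (k : ℕ) (z : Z) : featureMap lam u z k = √(lam k) * posEigen lam u k z := by
  by_cases hk : 0 < lam k
  · simp [featureMap, posEigen_of_pos hk]
  · simp [featureMap, le_antisymm (not_lt.1 hk) (h0 k)]

section Eigensystem

variable {Z : Type*} [MeasurableSpace Z] {μ : Measure Z} {κ : Z → Z → ℝ} {lam : ℕ → ℝ}
  {u : ℕ → Z → ℝ}

namespace IsEigensystem

lemma memLp_posEigen (hu : IsEigensystem μ κ lam u) (k : ℕ) : MemLp (posEigen lam u k) 2 μ := by
  by_cases hk : 0 < lam k
  · rw [posEigen_of_pos hk]; exact hu.memLp k hk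
  · rw [posEigen_of_not_pos hk]; exact MemLp.zero'

lemma integral_posEigen_mul (hu : IsEigensystem μ κ lam u) (k l : ℕ) :
    ∫ z, posEigen lam u k z * posEigen lam u l z ∂μ
      = open Classical in if k = l ∧ 0 < lam k then (1 : ℝ) else 0 := by
  by_cases hk : 0 < lam k
  · by_cases hl : 0 < lam l
    · rw [posEigen_of_pos hk, posEigen_of_pos hl, hu.orthonormal k l hk hl]
      simp [hk]
    · have : k ≠ l := by rintro rfl; exact hl hk
      simp [posEigen_of_not_pos hl, this]
  · simp [posEigen_of_not_pos hk, hk]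

lemma integral_kernel_mul_posEigen (hu : IsEigensystem μ κ lam u) (k : ℕ) (z : Z) :
    ∫ z', κ z z' * posEigen lam u k z' ∂μ = lam k * posEigen lam u k z := by
  by_cases hk : 0 < lam k
  · rw [posEigen_of_pos hk]; exact hu.eigen k hk z
  · simp [posEigen_of_not_pos hk]

/-- Square integrability only provides a measurable version of `u k`. The eigenvalue equation at
every point writes `u k` itself as an integral of the kernel against that version. -/
lemma measurable_posEigen [SFinite μ] (hu : IsEigensystem μ κ lam u)
    (hκ : Measurable (Function.uncurry κ)) (k : ℕ) : Measurable (posEigen lam u k) := by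
  by_cases hk : 0 < lam k
  · obtain ⟨v, hv, hvu⟩ := (hu.memLp_posEigen k).1
    have e : posEigen lam u k = fun z => (lam k)⁻¹ * ∫ z', κ z z' * v z' ∂μ := by
      ext z
      have : ∫ z', κ z z' * v z' ∂μ = ∫ z', κ z z' * posEigen lam u k z' ∂μ :=
        integral_congr_ae (by filter_upwards [hvu] with z' h; rw [h])
      rw [this, hu.integral_kernel_mul_posEigen, inv_mul_cancel_left₀ hk.ne']
    rw [e]
    have hm : Measurable fun q : Z × Z => κ q.1 q.2 * v q.2 :=
      hκ.mul (hv.measurable.comp measurable_snd)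
    exact (hm.stronglyMeasurable.integral_prod_right').measurable.const_mul _
  · rw [posEigen_of_not_pos hk]; exact measurable_const

end IsEigensystem

variable {Ω : Type*} [MeasurableSpace Ω] {P : Measure Ω} [IsProbabilityMeasure P]
  [IsProbabilityMeasure μ] {p : ℕ} {F : Fin p → Ω → Z → ℝ} {C : ℝ}

lemma measurable_kernel (hF : ∀ j, IsSecondOrder P (F j) C)
    (hκ : ∀ z z', κ z z' = (p : ℝ)⁻¹ * ∫ ω, ∑ j, F j ω z * F j ω z' ∂P) :
    Measurable (Function.uncurry κ) := by
  have e : Function.uncurry κ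
      = fun q : Z × Z => (p : ℝ)⁻¹ * ∫ ω, ∑ j, F j ω q.1 * F j ω q.2 ∂P := by
    ext q; exact hκ q.1 q.2
  rw [e]
  have hm : Measurable fun q : (Z × Z) × Ω => ∑ j, F j q.2 q.1.1 * F j q.2 q.1.2 := by
    refine Finset.measurable_fun_sum _ fun j _ => Measurable.mul ?_ ?_
    · exact (hF j).measurable.comp (measurable_snd.prodMk (measurable_fst.comp measurable_fst))
    · exact (hF j).measurable.comp (measurable_snd.prodMk (measurable_snd.comp measurable_fst))
  exact (hm.stronglyMeasurable.integral_prod_right').measurable.const_mul _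

lemma sum_integral_mul_coef (hp : 1 ≤ p) (hF : ∀ j, IsSecondOrder P (F j) C)
    (hκ : ∀ z z', κ z z' = (p : ℝ)⁻¹ * ∫ ω, ∑ j, F j ω z * F j ω z' ∂P)
    {h : Z → ℝ} (hh : MemLp h 2 μ) (z : Z) :
    ∑ j, ∫ ω, F j ω z * ∫ z', F j ω z' * h z' ∂μ ∂P = p * ∫ z', κ z z' * h z' ∂μ := by
  have hp0 : (p : ℝ) ≠ 0 := by positivity
  simp_rw [fun j => (hF j).integral_mul_coef hh z]
  rw [← integral_finsetSum, ← integral_const_mul]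
  · refine integral_congr_ae (Eventually.of_forall fun z' => ?_)
    simp only
    have e : ∫ ω, ∑ j, F j ω z * F j ω z' ∂P = ∑ j, ∫ ω, F j ω z * F j ω z' ∂P :=
      integral_finsetSum _ fun j _ => ((hF j).memLp z).integrable_mul ((hF j).memLp z')
    rw [hκ, e, ← Finset.sum_mul]
    field_simp
  · intro j _
    have hI : Integrable (fun q : Ω × Z => F j q.1 z * (F j q.1 q.2 * h q.2)) (P.prod μ) := by
      have := ((hF j).memLp_prod μ).integrable_mul (((hF j).memLp z).mul_prod hh)
      refine this.congr (Eventually.of_forall fun q => ?_)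
      simp [Function.uncurry]; ring
    refine hI.integral_prod_right.congr (Eventually.of_forall fun z' => ?_)
    refine (integral_congr_ae (Eventually.of_forall fun ω => ?_)).trans (integral_mul_const _ _)
    simp only; ring

/-- With eigenfunctions for `h` and `h'`, this says that the coefficients are uncorrelated in total
over `j`, with second moment `p * lam k`; with `h = h'` in the null space, it says that they vanish.
-/
lemma sum_integral_coef_mul_coef (hp : 1 ≤ p) (hF : ∀ j, IsSecondOrder P (F j) C)
    (hκ : ∀ z z', κ z z' = (p : ℝ)⁻¹ * ∫ ω, ∑ j, F j ω z * F j ω z' ∂P)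
    {h h' : Z → ℝ} (hh : MemLp h 2 μ) (hh' : MemLp h' 2 μ) :
    ∑ j, ∫ ω, (∫ z, F j ω z * h z ∂μ) * (∫ z, F j ω z * h' z ∂μ) ∂P
      = p * ∫ z, (∫ z', κ z z' * h z' ∂μ) * h' z ∂μ := by
  simp_rw [fun j => (hF j).integral_coef_mul_coef hh hh']
  rw [← integral_finsetSum _ fun j _ => (hF j).integrable_integral_mul_coef_mul hh hh',
    ← integral_const_mul]
  refine integral_congr_ae (Eventually.of_forall fun z => ?_)
  simp only
  rw [← Finset.sum_mul, sum_integral_mul_coef hp hF hκ hh, mul_assoc]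

/-- Bessel's inequality in `L²(P)`: from `F j · z` subtract the random coefficients weighted by `v k
z`. Summed over `j`, the scalar products and the quadratic form both equal `p ∑ λ_k v_k(z)²`, so
this is at most `∑ j, E F_j(z)² ≤ p C`. It holds at every `z` because the eigenvalue equation does.
-/
lemma sum_lam_mul_posEigen_sq_le (hp : 1 ≤ p) (hF : ∀ j, IsSecondOrder P (F j) C)
    (hκ : ∀ z z', κ z z' = (p : ℝ)⁻¹ * ∫ ω, ∑ j, F j ω z * F j ω z' ∂P)
    (hu : IsEigensystem μ κ lam u) (z : Z) (r : ℕ) :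
    ∑ k ∈ Finset.range r, lam k * posEigen lam u k z ^ 2 ≤ C := by
  classical
  have hp0 : (0 : ℝ) < p := by positivity
  set v := posEigen lam u
  have hv := hu.memLp_posEigen
  have h0 : ∀ j, 0 ≤ ∫ ω, F j ω z ^ 2 ∂P
      - 2 * ∑ k ∈ Finset.range r, v k z * ∫ ω, F j ω z * ∫ z', F j ω z' * v k z' ∂μ ∂P
      + ∑ k ∈ Finset.range r, ∑ l ∈ Finset.range r, v k z * v l z *
        ∫ ω, (∫ z', F j ω z' * v l z' ∂μ) * (∫ z', F j ω z' * v k z' ∂μ) ∂P := fun j =>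
    bessel_quadratic_nonneg ((hF j).memLp z) (fun k => (hF j).memLp_coef (hv k))
      (fun k => v k z) (Finset.range r)
  have h1 := Finset.sum_nonneg fun (j : Fin p) (_ : j ∈ Finset.univ) => h0 j
  rw [Finset.sum_add_distrib, Finset.sum_sub_distrib, ← Finset.mul_sum, Finset.sum_comm] at h1
  have h2 : ∑ k ∈ Finset.range r, ∑ j, v k z * ∫ ω, F j ω z * ∫ z', F j ω z' * v k z' ∂μ ∂P
      = p * ∑ k ∈ Finset.range r, lam k * v k z ^ 2 := by
    rw [Finset.mul_sum]
    refine Finset.sum_congr rfl fun k _ => ?_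
    rw [← Finset.mul_sum, sum_integral_mul_coef hp hF hκ (hv k), hu.integral_kernel_mul_posEigen]
    ring
  have h3 : ∑ j, ∑ k ∈ Finset.range r, ∑ l ∈ Finset.range r, v k z * v l z *
        ∫ ω, (∫ z', F j ω z' * v l z' ∂μ) * (∫ z', F j ω z' * v k z' ∂μ) ∂P
      = p * ∑ k ∈ Finset.range r, lam k * v k z ^ 2 := by
    rw [Finset.sum_comm, Finset.mul_sum]
    refine Finset.sum_congr rfl fun k hk => ?_
    rw [Finset.sum_comm]
    have e : ∀ l, ∑ j, v k z * v l z *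
        ∫ ω, (∫ z', F j ω z' * v l z' ∂μ) * (∫ z', F j ω z' * v k z' ∂μ) ∂P
        = v k z * v l z * (p * (lam l * if l = k ∧ 0 < lam l then 1 else 0)) := by
      intro l
      rw [← Finset.mul_sum, sum_integral_coef_mul_coef hp hF hκ (hv l) (hv k)]
      simp_rw [v, hu.integral_kernel_mul_posEigen, mul_assoc, integral_const_mul,
        hu.integral_posEigen_mul]
    simp_rw [e]
    rw [Finset.sum_eq_single_of_mem k hk]
    · by_cases hpos : 0 < lam k
      · simp [hpos]; ring
      · simp [v, posEigen_of_not_pos hpos]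
    · intro l _ hl
      simp [hl]
  have h4 : ∑ j, ∫ ω, F j ω z ^ 2 ∂P ≤ p * C := by
    refine (Finset.sum_le_sum fun j _ => (hF j).le z).trans ?_
    simp
  rw [h2, h3] at h1
  have : (p : ℝ) * ∑ k ∈ Finset.range r, lam k * v k z ^ 2 ≤ p * C := by linarith
  exact le_of_mul_le_mul_left this hp0

/-- Almost surely, the coordinates are orthogonal to the complement of the eigenfunctions. -/
lemma ae_inner_eq_zero [IsSeparable μ] (hp : 1 ≤ p) (hF : ∀ j, IsSecondOrder P (F j) C)
    (hκ : ∀ z z', κ z z' = (p : ℝ)⁻¹ * ∫ ω, ∑ j, F j ω z * F j ω z' ∂P)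
    (hu : IsEigensystem μ κ lam u) :
    ∀ᵐ ω ∂P, ∀ j (hf : MemLp (F j ω) 2 μ) (h : Lp ℝ 2 μ),
      (∀ k, inner ℝ h ((hu.memLp_posEigen k).toLp (posEigen lam u k)) = 0) →
      inner ℝ (hf.toLp (F j ω)) h = 0 := by
  have : Fact ((2 : ℝ≥0∞) ≠ ∞) := ⟨by norm_num⟩
  set S : Set (Lp ℝ 2 μ) :=
    {h | ∀ k, inner ℝ h ((hu.memLp_posEigen k).toLp (posEigen lam u k)) = 0} with hS
  have hsep : TopologicalSpace.IsSeparable S := TopologicalSpace.IsSeparable.of_separableSpace S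
  obtain ⟨T, hTS, hTc, hT⟩ := hsep.exists_countable_dense_subset
  -- `complete` places `h` in the null space of the operator, so `∑ j, E ⟨F_j, h⟩² = 0`. The
  -- exceptional null set depends on `h`; the countable dense `T` makes it uniform, and continuity
  -- of the inner product extends from `T` to `S`.
  have hone : ∀ h ∈ S, ∀ᵐ ω ∂P, ∀ j, ∫ z, F j ω z * h z ∂μ = 0 := by
    intro h hh
    have hm : MemLp h 2 μ := Lp.memLp h
    have hc := hu.complete h hm fun k hk => by
      have := hh k
      rw [← Lp.toLp_coeFn h hm, inner_toLp_eq_integral hm, posEigen_of_pos hk] at this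
      exact this
    have h0 : ∑ j, ∫ ω, (∫ z, F j ω z * h z ∂μ) * (∫ z, F j ω z * h z ∂μ) ∂P = 0 := by
      rw [sum_integral_coef_mul_coef hp hF hκ hm hm]
      refine mul_eq_zero_of_right _ (integral_eq_zero_of_ae ?_)
      filter_upwards [hc] with z hz
      simp [hz]
    rw [Finset.sum_eq_zero_iff_of_nonneg
      fun j _ => integral_nonneg fun ω => mul_self_nonneg _] at h0
    rw [ae_all_iff]
    intro j
    have h1 := h0 j (Finset.mem_univ j)
    rw [integral_eq_zero_iff_of_nonneg (fun ω => mul_self_nonneg _)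
      (((hF j).memLp_coef hm).integrable_mul ((hF j).memLp_coef hm))] at h1
    filter_upwards [h1] with ω hω
    exact mul_self_eq_zero.1 hω
  have hall : ∀ᵐ ω ∂P, ∀ h ∈ T, ∀ j, ∫ z, F j ω z * h z ∂μ = 0 :=
    (ae_ball_iff hTc).2 fun h hh => hone h (hTS hh)
  filter_upwards [hall] with ω hω j hf h hh
  have hcl : IsClosed {h : Lp ℝ 2 μ | inner ℝ (hf.toLp (F j ω)) h = 0} :=
    isClosed_eq (by fun_prop) continuous_const
  have hsub : T ⊆ {h : Lp ℝ 2 μ | inner ℝ (hf.toLp (F j ω)) h = 0} := fun h hh => by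
    have := inner_toLp_eq_integral hf (Lp.memLp h)
    rw [Lp.toLp_coeFn] at this
    exact this.trans (hω h hh j)
  exact hcl.closure_subset_iff.2 hsub (hT hh)

/-- The eigenexpansion of a second order random function converges almost everywhere. -/
theorem ae_ae_tendsto_eigenexpansion [IsSeparable μ] (hp : 1 ≤ p)
    (hF : ∀ j, IsSecondOrder P (F j) C)
    (hκ : ∀ z z', κ z z' = (p : ℝ)⁻¹ * ∫ ω, ∑ j, F j ω z * F j ω z' ∂P)
    (hu : IsEigensystem μ κ lam u) (hlam : Summable fun k : ℕ => ((k : ℝ) + 1) * lam k) (j : Fin p) :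
    ∀ᵐ ω ∂P, ∀ᵐ z ∂μ, Tendsto (fun r : ℕ => ∑ k ∈ Finset.range r,
      (∫ z, F j ω z * posEigen lam u k z ∂μ) * posEigen lam u k z) atTop (𝓝 (F j ω z)) := by
  have hv := hu.memLp_posEigen
  -- The sum over all coordinates is at most `p * lam k`, and a single coordinate is at most that
  -- sum.
  have hcoef : ∀ k, ∫ ω, (∫ z, F j ω z * posEigen lam u k z ∂μ) ^ 2 ∂P ≤ p * lam k := by
    intro k
    have h1 := sum_integral_coef_mul_coef hp hF hκ (hv k) (hv k)
    simp_rw [hu.integral_kernel_mul_posEigen, mul_assoc, integral_const_mul,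
      hu.integral_posEigen_mul] at h1
    refine le_trans ?_ (h1.le.trans ?_)
    · simp_rw [pow_two]
      exact Finset.single_le_sum (f := fun j => ∫ ω, (∫ z, F j ω z * posEigen lam u k z ∂μ) *
        (∫ z, F j ω z * posEigen lam u k z ∂μ) ∂P)
        (fun j _ => integral_nonneg fun ω => mul_self_nonneg _) (Finset.mem_univ j)
    · refine mul_le_mul_of_nonneg_left ?_ (Nat.cast_nonneg p)
      refine mul_le_of_le_one_right (hu.nonneg k) ?_
      split_ifs <;> norm_num
  have hsum : ∀ᵐ ω ∂P, Summable fun k : ℕ =>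
      ((k : ℝ) + 1) * (∫ z, F j ω z * posEigen lam u k z ∂μ) ^ 2 := by
    refine ae_summable_of_integral_le (b := fun k : ℕ => p * (((k : ℝ) + 1) * lam k))
      (fun k => ((hF j).memLp_coef (hv k)).integrable_sq.const_mul _)
      (fun k ω => by positivity) (fun k => ?_) (hlam.mul_left _)
    rw [integral_const_mul, mul_left_comm]
    exact mul_le_mul_of_nonneg_left (hcoef k) (by positivity)
  filter_upwards [hsum, (hF j).ae_memLp μ, ae_inner_eq_zero hp hF hκ hu] with ω h1 h2 h3
  exact ae_tendsto_expansion h2 hv hu.integral_posEigen_mul (h3 j h2) h1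

end Eigensystem

/-! ### Conditional expectations of functions of independent sources -/

lemma lintegral_lintegral_of_indepFun {Ω α β : Type*} [MeasurableSpace Ω] [MeasurableSpace α]
    [MeasurableSpace β] {P : Measure Ω} [IsProbabilityMeasure P] {X : Ω → α} {Y : Ω → β}
    (hX : Measurable X) (hY : Measurable Y) (hXY : IndepFun X Y P) {F : α × β → ℝ≥0∞}
    (hF : Measurable F) :
    ∫⁻ ω, ∫⁻ ω', F (X ω, Y ω') ∂P ∂P = ∫⁻ ω, F (X ω, Y ω) ∂P := by
  have h := (indepFun_iff_map_prod_eq_prod_map_map hX.aemeasurable hY.aemeasurable).1 hXY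
  have : SFinite (P.map Y) := inferInstance
  calc ∫⁻ ω, ∫⁻ ω', F (X ω, Y ω') ∂P ∂P
      = ∫⁻ ω, ∫⁻ b, F (X ω, b) ∂(P.map Y) ∂P := by
        refine lintegral_congr fun ω => ?_
        exact (lintegral_map (hF.comp measurable_prodMk_left) hY).symm
    _ = ∫⁻ a, ∫⁻ b, F (a, b) ∂(P.map Y) ∂(P.map X) := by
        rw [lintegral_map hF.lintegral_prod_right' hX]
    _ = ∫⁻ q, F q ∂((P.map X).prod (P.map Y)) := (lintegral_prod _ hF.aemeasurable).symm
    _ = ∫⁻ ω, F (X ω, Y ω) ∂P := by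
        rw [← h, lintegral_map hF (hX.prodMk hY)]

/-- Conditioning on one of two independent variables integrates out the other one. -/
lemma condLExp_ae_eq_lintegral_of_indepFun {Ω α β : Type*} [MeasurableSpace Ω]
    [mα : MeasurableSpace α] [MeasurableSpace β] {P : Measure Ω} [IsProbabilityMeasure P]
    {X : Ω → α} {Y : Ω → β} (hX : Measurable X) (hY : Measurable Y) (hXY : IndepFun X Y P)
    {F : α × β → ℝ≥0∞} (hF : Measurable F) :
    condLExp (mα.comap X) P (fun ω => F (X ω, Y ω))
      =ᵐ[P] fun ω => ∫⁻ ω', F (X ω, Y ω') ∂P := by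
  have hG : Measurable fun a => ∫⁻ ω', F (a, Y ω') ∂P := by
    have : Measurable fun q : α × Ω => F (q.1, Y q.2) :=
      hF.comp (measurable_fst.prodMk (hY.comp measurable_snd))
    exact this.lintegral_prod_right'
  refine (ae_eq_condLExp hX.comap_le P _ (hG.comp (comap_measurable X)) ?_).symm
  rintro s ⟨t, ht, rfl⟩
  have hF' : Measurable ((t ×ˢ (Set.univ : Set β)).indicator F) :=
    hF.indicator (ht.prod MeasurableSet.univ)
  have h := lintegral_lintegral_of_indepFun hX hY hXY hF'
  rw [← lintegral_indicator (hX ht), ← lintegral_indicator (hX ht)]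
  refine Eq.trans (lintegral_congr fun ω => ?_) (h.trans (lintegral_congr fun ω => ?_))
  · by_cases hω : X ω ∈ t <;> simp [Set.indicator, hω]
  · by_cases hω : X ω ∈ t <;> simp [Set.indicator, hω]

/-! ### Measurability of the matrices and estimators -/

section Measurability

variable {α : Type*} [MeasurableSpace α]

lemma measurable_seqDot {v w : α → ℕ → ℝ} (hv : ∀ k, Measurable fun a => v a k)
    (hw : ∀ k, Measurable fun a => w a k) : Measurable fun a => seqDot (v a) (w a) := by
  refine (StronglyMeasurable.limUnder (l := atTop) fun r => ?_).measurable
  exact (Finset.measurable_fun_sum _ fun k _ => (hv k).mul (hw k)).stronglyMeasurable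

lemma measurable_mulVec {ι ι' : Type*} [Fintype ι'] {M : α → Matrix ι ι' ℝ} {v : α → ι' → ℝ}
    (hM : ∀ i j, Measurable fun a => M a i j) (hv : ∀ j, Measurable fun a => v a j) (i : ι) :
    Measurable fun a => (M a *ᵥ v a) i :=
  Finset.measurable_fun_sum _ fun j _ => (hM i j).mul (hv j)

lemma measurable_dotProduct {ι : Type*} [Fintype ι] {v w : α → ι → ℝ}
    (hv : ∀ j, Measurable fun a => v a j) (hw : ∀ j, Measurable fun a => w a j) :
    Measurable fun a => v a ⬝ᵥ w a :=
  Finset.measurable_fun_sum _ fun j _ => (hv j).mul (hw j)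

lemma measurable_det {n : ℕ} {M : α → Matrix (Fin n) (Fin n) ℝ}
    (hM : ∀ i j, Measurable fun a => M a i j) : Measurable fun a => (M a).det := by
  simp only [Matrix.det_apply']
  exact Finset.measurable_fun_sum _ fun σ _ =>
    (Finset.measurable_fun_prod _ fun i _ => hM (σ i) i).const_mul _

/-- Cramer's rule. It also covers singular matrices, since both the matrix inverse and the inverse
of a zero determinant are read as `0`. -/
lemma measurable_matrix_inv {n : ℕ} {M : α → Matrix (Fin n) (Fin n) ℝ}
    (hM : ∀ i j, Measurable fun a => M a i j) (i j : Fin n) :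
    Measurable fun a => (M a)⁻¹ i j := by
  have e : (fun a => (M a)⁻¹ i j)
      = fun a => ((M a).det)⁻¹ * ((M a).updateRow j (Pi.single i 1)).det := by
    ext a
    rw [Matrix.inv_def, Ring.inverse_eq_inv', Matrix.smul_apply, smul_eq_mul,
      Matrix.adjugate_apply]
  rw [e]
  refine (measurable_det hM).inv.mul (measurable_det fun k l => ?_)
  by_cases hk : k = j
  · subst hk
    simp
  · simpa [Matrix.updateRow_ne hk] using hM k l

end Measurability

namespace LatentData

variable {Ω Ξ Z : Type*} {n p : ℕ} [MeasurableSpace Ω] [MeasurableSpace Ξ] [MeasurableSpace Z]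

/-- All random variables of the model are measurable. -/
structure IsMeasurable (D : LatentData Ω Ξ Z n p) : Prop where
  ξ : Measurable D.ξ
  ψ : ∀ j, Measurable (fun q : Ξ × Z => D.ψ j q.1 q.2)
  z : ∀ i, Measurable (D.z i)
  zTest : Measurable D.zTest
  e : ∀ i j, Measurable (D.e i j)
  eTest : ∀ j, Measurable (D.eTest j)
  eps : ∀ i, Measurable (D.eps i)

lemma IsLatentMetricModel.isMeasurable {D : LatentData Ω Ξ Z n p} {P : Measure Ω} {μ : Measure Z}
    (hD : D.IsLatentMetricModel P μ) : D.IsMeasurable :=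
  ⟨hD.measurable_ξ, hD.measurable_ψ, hD.measurable_z, hD.measurable_zTest, hD.measurable_e,
    hD.measurable_eTest, hD.measurable_eps⟩

/-- `φ(z_test)ᵀ θ̂(y) - φ(z_test)ᵀ θ`, the error of the latent ridge estimator. -/
noncomputable def ridgeError (lam : ℕ → ℝ) (u : ℕ → Z → ℝ) (γ : ℝ) (g : Z → ℝ) (θ : ℕ → ℝ)
    (D : LatentData Ω Ξ Z n p) (ω : Ω) : ℝ :=
  seqDot (D.φTest lam u ω) (D.thetaHat lam u γ ω (D.y g ω)) - seqDot (D.φTest lam u ω) θ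

/-- `φ(z_test)ᵀ (Wᵀ W - I) θ̂(y)`. -/
noncomputable def gramError (lam : ℕ → ℝ) (u : ℕ → Z → ℝ) (μ : Measure Z) (γ : ℝ) (g : Z → ℝ)
    (D : LatentData Ω Ξ Z n p) (ω : Ω) : ℝ :=
  seqDot (seqVecMul (D.φTest lam u ω) (D.WtWsubI lam u μ ω)) (D.thetaHat lam u γ ω (D.y g ω))

/-- `φ(z_test)ᵀ Wᵀ Eᵀ A⁻¹ y`. -/
noncomputable def noiseError (lam : ℕ → ℝ) (u : ℕ → Z → ℝ) (μ : Measure Z) (γ : ℝ) (g : Z → ℝ)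
    (D : LatentData Ω Ξ Z n p) (ω : Ω) : ℝ :=
  seqVecMul (D.φTest lam u ω) (D.W lam u μ ω)ᵀ ⬝ᵥ ((D.E ω)ᵀ *ᵥ ((D.A γ ω)⁻¹ *ᵥ D.y g ω))

/-- `e_testᵀ Xᵀ A⁻¹ y`. -/
noncomputable def testNoiseError (γ : ℝ) (g : Z → ℝ) (D : LatentData Ω Ξ Z n p) (ω : Ω) : ℝ :=
  (fun j => D.eTest j ω) ⬝ᵥ ((D.X ω)ᵀ *ᵥ ((D.A γ ω)⁻¹ *ᵥ D.y g ω))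

namespace IsMeasurable

variable {D : LatentData Ω Ξ Z n p} {lam : ℕ → ℝ} {u : ℕ → Z → ℝ} {g : Z → ℝ}

lemma X (hD : D.IsMeasurable) (i : Fin n) (j : Fin p) : Measurable fun ω => D.X ω i j :=
  ((hD.ψ j).comp (hD.ξ.prodMk (hD.z i))).add ((hD.e i j).const_mul _)

lemma xTest (hD : D.IsMeasurable) (j : Fin p) : Measurable fun ω => D.xTest ω j :=
  ((hD.ψ j).comp (hD.ξ.prodMk hD.zTest)).add ((hD.eTest j).const_mul _)

lemma y (hD : D.IsMeasurable) (hg : Measurable g) (i : Fin n) : Measurable fun ω => D.y g ω i :=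
  (hg.comp (hD.z i)).add (hD.eps i)

lemma A (hD : D.IsMeasurable) (γ : ℝ) (i i' : Fin n) : Measurable fun ω => D.A γ ω i i' := by
  simp only [LatentData.A, Matrix.add_apply, Matrix.smul_apply, Matrix.mul_apply,
    Matrix.transpose_apply]
  exact ((Finset.measurable_fun_sum _ fun j _ =>
    (hD.X i j).mul (hD.X i' j)).const_mul (p : ℝ)⁻¹).add measurable_const

lemma A_inv_mulVec (hD : D.IsMeasurable) (γ : ℝ) {v : Ω → Fin n → ℝ}
    (hv : ∀ i, Measurable fun ω => v ω i) (i : Fin n) :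
    Measurable fun ω => ((D.A γ ω)⁻¹ *ᵥ v ω) i :=
  measurable_mulVec (measurable_matrix_inv (hD.A γ)) hv i

lemma φTest (hD : D.IsMeasurable) (hφ : ∀ k, Measurable fun z => featureMap lam u z k) (k : ℕ) :
    Measurable fun ω => D.φTest lam u ω k :=
  (hφ k).comp hD.zTest

lemma Φ (hD : D.IsMeasurable) (hφ : ∀ k, Measurable fun z => featureMap lam u z k) (i : Fin n)
    (k : ℕ) : Measurable fun ω => D.Φ lam u ω i k :=
  (hφ k).comp (hD.z i)

lemma thetaHat (hD : D.IsMeasurable) (hφ : ∀ k, Measurable fun z => featureMap lam u z k) (γ : ℝ)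
    {v : Ω → Fin n → ℝ} (hv : ∀ i, Measurable fun ω => v ω i) (k : ℕ) :
    Measurable fun ω => D.thetaHat lam u γ ω (v ω) k :=
  measurable_mulVec (fun k i => hD.Φ hφ i k) (hD.A_inv_mulVec γ hv) k

lemma W (hD : D.IsMeasurable) (hφ : ∀ k, Measurable fun z => featureMap lam u z k)
    (hlam : ∀ k, 0 ≤ lam k) (μ : Measure Z) [SFinite μ] (j : Fin p) (k : ℕ) :
    Measurable fun ω => D.W lam u μ ω j k := by
  by_cases hk : lam k = 0
  · simp [LatentData.W, hk]
  · simp only [LatentData.W, Matrix.of_apply, if_neg hk]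
    have hu : Measurable (u k) := by
      have h := (hφ k).const_mul (√(lam k))⁻¹
      have h0 : √(lam k) ≠ 0 := (Real.sqrt_ne_zero (hlam k)).2 hk
      simpa only [featureMap, inv_mul_cancel_left₀ h0] using h
    have hm : Measurable fun q : Ω × Z => D.ψ j (D.ξ q.1) q.2 * u k q.2 :=
      ((hD.ψ j).comp ((hD.ξ.comp measurable_fst).prodMk measurable_snd)).mul
        (hu.comp measurable_snd)
    exact (hm.stronglyMeasurable.integral_prod_right').measurable.const_mul _

lemma predError (hD : D.IsMeasurable) (hg : Measurable g) (γ : ℝ) :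
    Measurable fun ω => D.predError γ g ω := by
  refine ((measurable_dotProduct hD.xTest fun j => ?_).const_mul _).sub (hg.comp hD.zTest)
  exact (measurable_mulVec (fun j i => hD.X i j)
    (hD.A_inv_mulVec γ (hD.y hg)) j).const_smul _

lemma ridgeError (hD : D.IsMeasurable) (hφ : ∀ k, Measurable fun z => featureMap lam u z k)
    (hg : Measurable g) (γ : ℝ) (θ : ℕ → ℝ) : Measurable (D.ridgeError lam u γ g θ) :=
  (measurable_seqDot (hD.φTest hφ) (hD.thetaHat hφ γ (hD.y hg))).sub
    (measurable_seqDot (hD.φTest hφ) fun _ => measurable_const)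

lemma gramError (hD : D.IsMeasurable) (hφ : ∀ k, Measurable fun z => featureMap lam u z k)
    (hlam : ∀ k, 0 ≤ lam k) (μ : Measure Z) [SFinite μ] (hg : Measurable g) (γ : ℝ) :
    Measurable (D.gramError lam u μ γ g) := by
  refine measurable_seqDot (fun k => measurable_seqDot (hD.φTest hφ) fun l => ?_)
    (hD.thetaHat hφ γ (hD.y hg))
  simp only [WtWsubI, Matrix.sub_apply, Matrix.mul_apply, Matrix.transpose_apply]
  exact (Finset.measurable_fun_sum _ fun j _ =>
    (hD.W hφ hlam μ j l).mul (hD.W hφ hlam μ j k)).sub measurable_const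

lemma noiseError (hD : D.IsMeasurable) (hφ : ∀ k, Measurable fun z => featureMap lam u z k)
    (hlam : ∀ k, 0 ≤ lam k) (μ : Measure Z) [SFinite μ] (hg : Measurable g) (γ : ℝ) :
    Measurable (D.noiseError lam u μ γ g) :=
  measurable_dotProduct (fun j => measurable_seqDot (hD.φTest hφ) (hD.W hφ hlam μ j))
    (measurable_mulVec (fun j i => hD.e i j) (hD.A_inv_mulVec γ (hD.y hg)))

lemma testNoiseError (hD : D.IsMeasurable) (hg : Measurable g) (γ : ℝ) :
    Measurable (D.testNoiseError γ g) :=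
  measurable_dotProduct hD.eTest
    (measurable_mulVec (fun j i => hD.X i j) (hD.A_inv_mulVec γ (hD.y hg)))

lemma lamNormSq_thetaHat (hD : D.IsMeasurable)
    (hφ : ∀ k, Measurable fun z => featureMap lam u z k) (γ : ℝ) :
    Measurable fun ω => lamNormSq lam (D.thetaHat lam u γ ω (D.epsVec ω)) :=
  Measurable.tsum fun k =>
    (((hD.thetaHat hφ γ hD.eps k).pow_const 2).const_mul _).ennreal_ofReal

end IsMeasurable

end LatentData

/-! ### Integrating out a set of sources -/

namespace LatentData

variable {Ω Ξ Z : Type*} {n p : ℕ}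

/-- The data `D` on the probability space `Ω'`, pulled back along `h : Ω' → Ω`. -/
def pullback {Ω' : Type*} (D : LatentData Ω Ξ Z n p) (h : Ω' → Ω) : LatentData Ω' Ξ Z n p where
  ξ ω := D.ξ (h ω)
  ψ := D.ψ
  z i ω := D.z i (h ω)
  zTest ω := D.zTest (h ω)
  e i j ω := D.e i j (h ω)
  eTest j ω := D.eTest j (h ω)
  eps i ω := D.eps i (h ω)
  σx := D.σx
  σy := D.σy

open Classical in
/-- The outcome that determines the source `s`: the second one if `s ∈ T`, the first one
otherwise. -/
noncomputable def outcome (T : Set (Source n p)) (s : Source n p) (q : Ω × Ω) : Ω :=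
  if s ∈ T then q.2 else q.1

/-- The data in which the sources in `T` are taken from a second outcome. -/
noncomputable def splice (D : LatentData Ω Ξ Z n p) (T : Set (Source n p)) :
    LatentData (Ω × Ω) Ξ Z n p where
  ξ q := D.ξ (outcome T .psi q)
  ψ := D.ψ
  z i q := D.z i (outcome T (.z i) q)
  zTest q := D.zTest (outcome T .zTest q)
  e i j q := D.e i j (outcome T (.e i j) q)
  eTest j q := D.eTest j (outcome T (.eTest j) q)
  eps i q := D.eps i (outcome T (.eps i) q)
  σx := D.σx
  σy := D.σy

lemma splice_pullback_diag (D : LatentData Ω Ξ Z n p) (T : Set (Source n p)) :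
    (D.splice T).pullback (fun ω => (ω, ω)) = D := by
  simp [splice, pullback, outcome]

variable [MeasurableSpace Ξ] [MeasurableSpace Z]

/-- The σ-algebra generated by the sources in `T`. -/
@[reducible] def sigmaOf (D : LatentData Ω Ξ Z n p) (T : Set (Source n p)) : MeasurableSpace Ω :=
  ⨆ s ∈ T, D.sigma s

/-- A source reads only one of the two outcomes, the one whose σ-algebra contains it. Measurability
for this small product σ-algebra is what lets `expectOver_ae_eq` use the independence of the two
factors. -/
lemma measurable_outcome_comp {β : Type*} [mβ : MeasurableSpace β] (D : LatentData Ω Ξ Z n p)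
    (T : Set (Source n p)) (s : Source n p) (f : Ω → β) (hf : mβ.comap f ≤ D.sigma s) :
    Measurable[(D.sigmaOf Tᶜ).prod (D.sigmaOf T)] fun q : Ω × Ω => f (outcome T s q) := by
  by_cases hs : s ∈ T
  · have h1 : Measurable[D.sigmaOf T] f :=
      measurable_iff_comap_le.2 (hf.trans (le_iSup₂_of_le s hs le_rfl))
    simp only [outcome, if_pos hs]
    exact @Measurable.comp _ _ _ ((D.sigmaOf Tᶜ).prod (D.sigmaOf T)) (D.sigmaOf T) _ _ _ h1
      (@measurable_snd _ _ (D.sigmaOf Tᶜ) (D.sigmaOf T))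
  · have h1 : Measurable[D.sigmaOf Tᶜ] f :=
      measurable_iff_comap_le.2 (hf.trans (le_iSup₂_of_le s hs le_rfl))
    simp only [outcome, if_neg hs]
    exact @Measurable.comp _ _ _ ((D.sigmaOf Tᶜ).prod (D.sigmaOf T)) (D.sigmaOf Tᶜ) _ _ _ h1
      (@measurable_fst _ _ (D.sigmaOf Tᶜ) (D.sigmaOf T))

variable [mΩ : MeasurableSpace Ω]

lemma IsMeasurable.sigmaOf_le {D : LatentData Ω Ξ Z n p} (hD : D.IsMeasurable)
    (T : Set (Source n p)) : D.sigmaOf T ≤ mΩ := by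
  refine iSup₂_le fun s _ => ?_
  cases s with
  | psi => exact hD.ξ.comap_le
  | z i => exact (hD.z i).comap_le
  | zTest => exact hD.zTest.comap_le
  | e i j => exact (hD.e i j).comap_le
  | eTest j => exact (hD.eTest j).comap_le
  | eps i => exact (hD.eps i).comap_le

lemma IsMeasurable.splice {D : LatentData Ω Ξ Z n p} (hD : D.IsMeasurable)
    (T : Set (Source n p)) :
    @IsMeasurable (Ω × Ω) Ξ Z n p ((D.sigmaOf Tᶜ).prod (D.sigmaOf T)) _ _ (D.splice T) :=
  letI := (D.sigmaOf Tᶜ).prod (D.sigmaOf T)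
  { ξ := D.measurable_outcome_comp T .psi D.ξ le_rfl
    ψ := hD.ψ
    z := fun i => D.measurable_outcome_comp T (.z i) (D.z i) le_rfl
    zTest := D.measurable_outcome_comp T .zTest D.zTest le_rfl
    e := fun i j => D.measurable_outcome_comp T (.e i j) (D.e i j) le_rfl
    eTest := fun j => D.measurable_outcome_comp T (.eTest j) (D.eTest j) le_rfl
    eps := fun i => D.measurable_outcome_comp T (.eps i) (D.eps i) le_rfl }

lemma IsLatentMetricModel.indep_sigmaOf {D : LatentData Ω Ξ Z n p} {P : Measure Ω}
    {μ : Measure Z} (hD : D.IsLatentMetricModel P μ) {S T : Set (Source n p)}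
    (hST : Disjoint S T) : Indep (D.sigmaOf S) (D.sigmaOf T) P := by
  refine indep_iSup_of_disjoint (fun s => ?_) hD.indep hST
  have := hD.isMeasurable.sigmaOf_le {s}
  simpa [sigmaOf] using this

/-- The expectation over the sources in `T`, as an integral over independent copies of them. -/
theorem expectOver_ae_eq {Ω : Type*} [mΩ : MeasurableSpace Ω] {D : LatentData Ω Ξ Z n p}
    {P : Measure Ω} [IsProbabilityMeasure P] {μ : Measure Z} (hD : D.IsLatentMetricModel P μ)
    (T : Set (Source n p)) (f : ∀ {Ω' : Type _}, LatentData Ω' Ξ Z n p → Ω' → ℝ≥0∞)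
    (hf : ∀ {Ω₁ Ω₂ : Type _} (D' : LatentData Ω₁ Ξ Z n p) (h : Ω₂ → Ω₁) (ω : Ω₂),
      f (D'.pullback h) ω = f D' (h ω))
    (hfm : ∀ {Ω' : Type _} [MeasurableSpace Ω'] (D' : LatentData Ω' Ξ Z n p),
      D'.IsMeasurable → Measurable (f D')) :
    D.expectOver P T (f D) =ᵐ[P]
      fun ω => ∫⁻ ω', f ((D.splice T).pullback fun ω' => (ω, ω')) ω' ∂P := by
  have hm := hD.isMeasurable
  -- The conditioning variable and the one integrated out are both the identity of `Ω`; they differ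
  -- in the target σ-algebra, generated by the sources outside `T` and in `T`. That `f` commutes
  -- with pullbacks expresses that it sees `ω` only through the data.
  have hX : @Measurable Ω Ω mΩ (D.sigmaOf Tᶜ) id := measurable_id'' (hm.sigmaOf_le Tᶜ)
  have hY : @Measurable Ω Ω mΩ (D.sigmaOf T) id := measurable_id'' (hm.sigmaOf_le T)
  have hXY : @IndepFun Ω Ω Ω mΩ (D.sigmaOf Tᶜ) (D.sigmaOf T) id id P := by
    refine (@IndepFun_iff_Indep Ω Ω Ω mΩ (D.sigmaOf Tᶜ) (D.sigmaOf T) id id P).2 ?_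
    rw [MeasurableSpace.comap_id, MeasurableSpace.comap_id]
    exact hD.indep_sigmaOf disjoint_compl_left
  have hF : @Measurable (Ω × Ω) ℝ≥0∞ ((D.sigmaOf Tᶜ).prod (D.sigmaOf T)) _ (f (D.splice T)) :=
    @hfm (Ω × Ω) ((D.sigmaOf Tᶜ).prod (D.sigmaOf T)) _ (hm.splice T)
  have h := @condLExp_ae_eq_lintegral_of_indepFun Ω Ω Ω mΩ (D.sigmaOf Tᶜ) (D.sigmaOf T) P _ id id
    hX hY hXY _ hF
  rw [MeasurableSpace.comap_id] at h
  -- On the diagonal the two outcomes agree, so splicing changes nothing.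
  have e : (fun ω => f (D.splice T) (id ω, id ω)) = f D := by
    ext ω
    conv_rhs => rw [← D.splice_pullback_diag T, hf]
    rfl
  rw [e] at h
  refine h.trans (Eventually.of_forall fun ω => lintegral_congr fun ω' => ?_)
  rw [hf]
  rfl

/-- The data with the training covariates of the outcome `ω`, and random test data and response
noise. -/
def freezeTrain (D : LatentData Ω Ξ Z n p) (ω : Ω) : LatentData Ω Ξ Z n p where
  ξ _ := D.ξ ω
  ψ := D.ψ
  z i _ := D.z i ω
  zTest := D.zTest
  e i j _ := D.e i j ω
  eTest := D.eTest
  eps := D.eps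
  σx := D.σx
  σy := D.σy

lemma IsMeasurable.freezeTrain {D : LatentData Ω Ξ Z n p} (hD : D.IsMeasurable) (ω : Ω) :
    (D.freezeTrain ω).IsMeasurable where
  ξ := measurable_const
  ψ := hD.ψ
  z _ := measurable_const
  zTest := hD.zTest
  e _ _ := measurable_const
  eTest := hD.eTest
  eps := hD.eps

/-! ### The risk and the error terms as integrals over frozen training covariates. -/

section Model

variable {D : LatentData Ω Ξ Z n p} {P : Measure Ω} [IsProbabilityMeasure P] {μ : Measure Z}
  {lam : ℕ → ℝ} {u : ℕ → Z → ℝ} {g : Z → ℝ}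

lemma excessRisk_ae_eq (hD : D.IsLatentMetricModel P μ) (hg : Measurable g) (γ : ℝ) :
    D.excessRisk P γ g =ᵐ[P] fun ω =>
      ∫⁻ ω', ENNReal.ofReal (|(D.freezeTrain ω).predError γ g ω'| ^ 2) ∂P := by
  refine (expectOver_ae_eq hD _ (fun D' ω => ENNReal.ofReal (|D'.predError γ g ω| ^ 2))
    (fun _ _ _ => rfl) fun D' hD' => ((hD'.predError hg γ).abs.pow_const 2).ennreal_ofReal).trans
    (Eventually.of_forall fun ω => lintegral_congr fun ω' => ?_)
  have e : (D.splice (srcZTest n p ∪ srcETest n p ∪ srcEps n p)).pullback (fun ω' => (ω, ω'))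
      = D.freezeTrain ω := by
    simp [LatentData.splice, pullback, outcome, LatentData.freezeTrain, srcZTest, srcETest, srcEps]
  rw [e]

/-- Only `ε` is integrated out here, while `freezeTrain` also keeps the test data random; the
integrand does not read them. In the same way `S₁`, `S₂` and `S₃`, which integrate over different
sources, become integrals of one and the same frozen data. -/
lemma V_ae_eq (hD : D.IsLatentMetricModel P μ)
    (hφ : ∀ k, Measurable fun z => featureMap lam u z k) (γ : ℝ) :
    D.V lam u P γ =ᵐ[P] fun ω => ∫⁻ ω', lamNormSq lam
      ((D.freezeTrain ω).thetaHat lam u γ ω' ((D.freezeTrain ω).epsVec ω')) ∂P := by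
  refine (expectOver_ae_eq hD _ (fun D' ω => lamNormSq lam (D'.thetaHat lam u γ ω (D'.epsVec ω)))
    (fun _ _ _ => rfl) fun D' hD' => hD'.lamNormSq_thetaHat hφ γ).trans
    (Eventually.of_forall fun ω => lintegral_congr fun ω' => ?_)
  have e : (D.splice (srcEps n p)).pullback (fun ω' => (ω, ω'))
      = { D.freezeTrain ω with zTest := fun _ => D.zTest ω, eTest := fun j _ => D.eTest j ω } := by
    simp [LatentData.splice, pullback, outcome, LatentData.freezeTrain, srcEps]
  rw [e]
  rfl

lemma S₁_ae_eq [SFinite μ] (hD : D.IsLatentMetricModel P μ)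
    (hφ : ∀ k, Measurable fun z => featureMap lam u z k) (hlam : ∀ k, 0 ≤ lam k)
    (hg : Measurable g) (γ : ℝ) :
    D.S₁ lam u P μ γ g =ᵐ[P] fun ω =>
      ∫⁻ ω', ENNReal.ofReal (|(D.freezeTrain ω).gramError lam u μ γ g ω'| ^ 2) ∂P := by
  refine (expectOver_ae_eq hD _ (fun D' ω => ENNReal.ofReal (|D'.gramError lam u μ γ g ω| ^ 2))
    (fun _ _ _ => rfl)
    fun D' hD' => ((hD'.gramError hφ hlam μ hg γ).abs.pow_const 2).ennreal_ofReal).trans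
    (Eventually.of_forall fun ω => lintegral_congr fun ω' => ?_)
  have e : (D.splice (srcZTest n p ∪ srcEps n p)).pullback (fun ω' => (ω, ω'))
      = { D.freezeTrain ω with eTest := fun j _ => D.eTest j ω } := by
    simp [LatentData.splice, pullback, outcome, LatentData.freezeTrain, srcZTest, srcEps]
  rw [e]
  rfl

lemma S₂_ae_eq [SFinite μ] (hD : D.IsLatentMetricModel P μ)
    (hφ : ∀ k, Measurable fun z => featureMap lam u z k) (hlam : ∀ k, 0 ≤ lam k)
    (hg : Measurable g) (γ : ℝ) :
    D.S₂ lam u P μ γ g =ᵐ[P] fun ω => ENNReal.ofReal (D.σx ^ 2 / (p : ℝ)) *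
      ∫⁻ ω', ENNReal.ofReal (|(D.freezeTrain ω).noiseError lam u μ γ g ω'| ^ 2) ∂P := by
  have h := expectOver_ae_eq hD (srcZTest n p ∪ srcEps n p)
    (fun D' ω => ENNReal.ofReal (|D'.noiseError lam u μ γ g ω| ^ 2))
    (fun _ _ _ => rfl)
    fun D' hD' => ((hD'.noiseError hφ hlam μ hg γ).abs.pow_const 2).ennreal_ofReal
  filter_upwards [h] with ω hω
  have e : (D.splice (srcZTest n p ∪ srcEps n p)).pullback (fun ω' => (ω, ω'))
      = { D.freezeTrain ω with eTest := fun j _ => D.eTest j ω } := by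
    simp [LatentData.splice, pullback, outcome, LatentData.freezeTrain, srcZTest, srcEps]
  rw [e] at hω
  exact congrArg _ hω

lemma S₃_ae_eq (hD : D.IsLatentMetricModel P μ) (hg : Measurable g) (γ : ℝ) :
    D.S₃ P γ g =ᵐ[P] fun ω => ENNReal.ofReal (D.σx ^ 2 / (p : ℝ) ^ 2) *
      ∫⁻ ω', ENNReal.ofReal (|(D.freezeTrain ω).testNoiseError γ g ω'| ^ 2) ∂P := by
  have h := expectOver_ae_eq hD (srcETest n p ∪ srcEps n p)
    (fun D' ω => ENNReal.ofReal (|D'.testNoiseError γ g ω| ^ 2))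
    (fun _ _ _ => rfl)
    fun D' hD' => ((hD'.testNoiseError hg γ).abs.pow_const 2).ennreal_ofReal
  filter_upwards [h] with ω hω
  have e : (D.splice (srcETest n p ∪ srcEps n p)).pullback (fun ω' => (ω, ω'))
      = { D.freezeTrain ω with zTest := fun _ => D.zTest ω } := by
    simp [LatentData.splice, pullback, outcome, LatentData.freezeTrain, srcETest, srcEps]
  rw [e] at hω
  exact congrArg _ hω

end Model

end LatentData

/-! ### Products with infinitely many terms -/

/-- The partial sums `∑ k < r, v k * w k` converge to `s`. -/
def HasDot (v w : ℕ → ℝ) (s : ℝ) : Prop :=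
  Tendsto (fun r : ℕ => ∑ k ∈ Finset.range r, v k * w k) atTop (𝓝 s)

namespace HasDot

variable {v w : ℕ → ℝ} {s : ℝ}

lemma seqDot_eq (h : HasDot v w s) : seqDot v w = s := h.limUnder_eq

lemma symm (h : HasDot v w s) : HasDot w v s := by
  simpa only [HasDot, mul_comm] using h

lemma sub {w' : ℕ → ℝ} {s' : ℝ} (h : HasDot v w s) (h' : HasDot v w' s') :
    HasDot v (fun k => w k - w' k) (s - s') := by
  simpa only [HasDot, mul_sub, Finset.sum_sub_distrib] using Tendsto.sub h h'

lemma sum {ι : Type*} [Fintype ι] {w : ι → ℕ → ℝ} {s a : ι → ℝ} (h : ∀ i, HasDot v (w i) (s i)) :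
    HasDot v (fun k => ∑ i, w i k * a i) (∑ i, s i * a i) := by
  have := tendsto_finsetSum Finset.univ fun i _ => Tendsto.mul_const (a i) (h i)
  refine this.congr fun r => ?_
  simp only [Finset.mul_sum, Finset.sum_mul]
  rw [Finset.sum_comm]
  exact Finset.sum_congr rfl fun k _ => Finset.sum_congr rfl fun i _ => by ring

lemma single (v : ℕ → ℝ) (k : ℕ) : HasDot v (fun l => (1 : Matrix ℕ ℕ ℝ) l k) (v k) := by
  refine tendsto_const_nhds.congr' ?_
  filter_upwards [eventually_gt_atTop k] with r hr
  simp [Matrix.one_apply, hr]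

end HasDot

lemma hasDot_of_summable_sq {v w : ℕ → ℝ} (hv : Summable fun k => v k ^ 2)
    (hw : Summable fun k => w k ^ 2) : HasDot v w (seqDot v w) := by
  have hs : Summable fun k => v k * w k := by
    refine Summable.of_norm_bounded (hv.add hw) fun k => ?_
    rw [Real.norm_eq_abs, abs_le]
    constructor <;> nlinarith [sq_nonneg (v k + w k), sq_nonneg (v k - w k), sq_nonneg (v k),
      sq_nonneg (w k)]
  have h : HasDot v w (∑' k, v k * w k) := hs.hasSum.tendsto_sum_nat
  rwa [h.seqDot_eq]

lemma abs_seqDot_le {v w : ℕ → ℝ} {C : ℝ} (hv : ∀ r, ∑ k ∈ Finset.range r, v k ^ 2 ≤ C)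
    (hw : ∀ r, ∑ k ∈ Finset.range r, w k ^ 2 ≤ C) (h : HasDot v w (seqDot v w)) :
    |seqDot v w| ≤ C := by
  refine le_of_tendsto h.abs (Eventually.of_forall fun r => ?_)
  have hC : 0 ≤ C := (Finset.sum_nonneg fun k _ => sq_nonneg (v k)).trans (hv r)
  refine abs_le_of_sq_le_sq ?_ hC
  calc (∑ k ∈ Finset.range r, v k * w k) ^ 2
      ≤ (∑ k ∈ Finset.range r, v k ^ 2) * ∑ k ∈ Finset.range r, w k ^ 2 :=
        Finset.sum_mul_sq_le_sq_mul_sq _ _ _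
    _ ≤ C * C := mul_le_mul (hv r) (hw r) (Finset.sum_nonneg fun k _ => sq_nonneg _) hC
    _ = C ^ 2 := (pow_two C).symm

/-! ### Pointwise decompositions -/

namespace LatentData

variable {Ω Ξ Z : Type*} {n p : ℕ} {D : LatentData Ω Ξ Z n p} {lam : ℕ → ℝ} {u : ℕ → Z → ℝ}

/-- `θ̂(y)` is a finite combination of rows of `Φ`, so the infinite sum passes through the sum over
`i`. -/
lemma hasDot_thetaHat (hφ : ∀ z, Summable fun k => featureMap lam u z k ^ 2) {v : ℕ → ℝ}
    (hv : Summable fun k => v k ^ 2) (γ : ℝ) (ω : Ω) (y : Fin n → ℝ) :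
    HasDot v (D.thetaHat lam u γ ω y)
      (∑ i, seqDot v (D.Φ lam u ω i) * ((D.A γ ω)⁻¹ *ᵥ y) i) :=
  HasDot.sum fun i => hasDot_of_summable_sq hv (hφ (D.z i ω))

/-- `φ(z_test)ᵀ Φᵀ A⁻¹ y` is added and subtracted, and the two factors `p^{-1/2}` combine. Only
square summability of the features enters, so no outcome is excluded. -/
lemma predError_eq (hφ : ∀ z, Summable fun k => featureMap lam u z k ^ 2) {g : Z → ℝ}
    {θ : ℕ → ℝ} (hg : ∀ z, g z = seqDot (featureMap lam u z) θ) (γ : ℝ) (ω : Ω) :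
    D.predError γ g ω =
      seqDot (D.φTest lam u ω) (D.thetaHat lam u γ ω (D.y g ω)) - seqDot (D.φTest lam u ω) θ
      + ((p : ℝ)⁻¹ • (D.xTest ω ᵥ* (D.X ω)ᵀ) - seqVecMul (D.φTest lam u ω) (D.Φ lam u ω)ᵀ)
          ⬝ᵥ ((D.A γ ω)⁻¹ *ᵥ D.y g ω) := by
  have e0 : seqDot (D.φTest lam u ω) (D.thetaHat lam u γ ω (D.y g ω))
      = ∑ i, seqDot (D.φTest lam u ω) (D.Φ lam u ω i) * ((D.A γ ω)⁻¹ *ᵥ D.y g ω) i :=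
    (hasDot_thetaHat hφ (hφ (D.zTest ω)) γ ω (D.y g ω)).seqDot_eq
  rw [e0, sub_dotProduct, smul_dotProduct, ← dotProduct_mulVec]
  have e1 : D.predError γ g ω = (p : ℝ)⁻¹ * (D.xTest ω ⬝ᵥ (D.X ω)ᵀ *ᵥ ((D.A γ ω)⁻¹ *ᵥ D.y g ω))
      - seqDot (D.φTest lam u ω) θ := by
    have hs : (√(p : ℝ))⁻¹ * (√(p : ℝ))⁻¹ = (p : ℝ)⁻¹ := by
      rw [← mul_inv, Real.mul_self_sqrt (Nat.cast_nonneg p)]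
    rw [← hs, mul_assoc, ← smul_eq_mul (√(p : ℝ))⁻¹ (_ ⬝ᵥ _), ← dotProduct_smul]
    simp only [predError, hg]
    rfl
  rw [e1, smul_eq_mul]
  have e2 : seqVecMul (D.φTest lam u ω) (D.Φ lam u ω)ᵀ ⬝ᵥ ((D.A γ ω)⁻¹ *ᵥ D.y g ω)
      = ∑ i, seqDot (D.φTest lam u ω) (D.Φ lam u ω i) * ((D.A γ ω)⁻¹ *ᵥ D.y g ω) i := rfl
  rw [e2]
  linarith

lemma testNoiseError_eq (γ : ℝ) (g : Z → ℝ) (ω : Ω) :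
    D.testNoiseError γ g ω = ∑ i, (∑ j, D.eTest j ω * D.X ω i j) * ((D.A γ ω)⁻¹ *ᵥ D.y g ω) i := by
  rw [testNoiseError, dotProduct_mulVec]
  rfl

variable [MeasurableSpace Z] {μ : Measure Z}

/-- The feature expansions of `ψ_j(z_test)` and `ψ_j(z_i)` converge to these values. -/
def HasExpansions (D : LatentData Ω Ξ Z n p) (lam : ℕ → ℝ) (u : ℕ → Z → ℝ) (μ : Measure Z)
    (ω : Ω) : Prop :=
  ∀ j, HasDot (D.φTest lam u ω) (D.W lam u μ ω j) ((√(p : ℝ))⁻¹ * D.ψ j (D.ξ ω) (D.zTest ω)) ∧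
    ∀ i, HasDot (D.Φ lam u ω i) (D.W lam u μ ω j) ((√(p : ℝ))⁻¹ * D.ψ j (D.ξ ω) (D.z i ω))

/-- Each column of `Wᵀ W` is a finite combination of columns of `Wᵀ`, so the conditionally
convergent sums are interchanged only with the finite sum over `j`. -/
lemma seqVecMul_WtWsubI {ω : Ω} {v : ℕ → ℝ} {s : Fin p → ℝ}
    (hv : ∀ j, HasDot v (D.W lam u μ ω j) (s j)) :
    seqVecMul v (D.WtWsubI lam u μ ω) = fun k => ∑ j, D.W lam u μ ω j k * s j - v k := by
  ext k
  have h := (HasDot.sum (a := fun j => D.W lam u μ ω j k) hv).sub (HasDot.single v k)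
  refine Eq.trans (HasDot.seqDot_eq (s := ∑ j, s j * D.W lam u μ ω j k - v k) ?_) ?_
  · simpa only [WtWsubI, Matrix.sub_apply, Matrix.mul_apply, Matrix.transpose_apply] using h
  · simp only [mul_comm]

lemma hasDot_seqVecMul_WtWsubI {ω : Ω} {v w : ℕ → ℝ} {s t : Fin p → ℝ} {c : ℝ}
    (hv : ∀ j, HasDot v (D.W lam u μ ω j) (s j)) (hw : ∀ j, HasDot w (D.W lam u μ ω j) (t j))
    (hvw : HasDot v w c) :
    HasDot (seqVecMul v (D.WtWsubI lam u μ ω)) w (∑ j, t j * s j - c) := by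
  rw [seqVecMul_WtWsubI hv]
  exact ((HasDot.sum hw).sub hvw.symm).symm

/-- Let `Ψ i j = ψ_j(z_i)`. The expansions give `Φ Wᵀ = p^{-1/2} Ψ`, hence `Φ (Wᵀ W - I) Φᵀ = p⁻¹ Ψ
Ψᵀ - K`. With `X = Ψ + σx E`, the terms `K` and `σx² I` make up for what `Δ` subtracts. -/
lemma A_eq (hp : 1 ≤ p) (hφ : ∀ z, Summable fun k => featureMap lam u z k ^ 2) (γ : ℝ) {ω : Ω}
    (h : D.HasExpansions lam u μ ω) :
    D.A γ ω = D.K lam u ω + (D.σx ^ 2 + (n : ℝ) * γ) • (1 : Matrix (Fin n) (Fin n) ℝ)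
        + D.Δ lam u μ ω := by
  have hp0 : (p : ℝ) ≠ 0 := by positivity
  have hs : √(p : ℝ) * √(p : ℝ) = p := Real.mul_self_sqrt (Nat.cast_nonneg p)
  have hs0 : √(p : ℝ) ≠ 0 := by positivity
  have hK : ∀ i i', HasDot (D.Φ lam u ω i) (D.Φ lam u ω i') (D.K lam u ω i i') :=
    fun i i' => hasDot_of_summable_sq (hφ _) (hφ _)
  ext i i'
  have e1 : seqMul (seqMul (D.Φ lam u ω) (D.WtWsubI lam u μ ω)) (D.Φ lam u ω)ᵀ i i'
      = ∑ j, (√(p : ℝ))⁻¹ * D.ψ j (D.ξ ω) (D.z i' ω) * ((√(p : ℝ))⁻¹ * D.ψ j (D.ξ ω) (D.z i ω))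
        - D.K lam u ω i i' :=
    (hasDot_seqVecMul_WtWsubI (fun j => (h j).2 i) (fun j => (h j).2 i') (hK i i')).seqDot_eq
  have e2 : ∀ i j, seqMul (D.Φ lam u ω) (D.W lam u μ ω)ᵀ i j
      = (√(p : ℝ))⁻¹ * D.ψ j (D.ξ ω) (D.z i ω) := fun i j => ((h j).2 i).seqDot_eq
  have e3 : ∀ i j, seqMul (D.W lam u μ ω) (D.Φ lam u ω)ᵀ j i
      = (√(p : ℝ))⁻¹ * D.ψ j (D.ξ ω) (D.z i ω) := fun i j => ((h j).2 i).symm.seqDot_eq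
  simp only [A, Δ, Matrix.add_apply, Matrix.smul_apply, Matrix.sub_apply, Matrix.mul_apply,
    Matrix.transpose_apply, e1, e2, e3, smul_eq_mul, X, E, Matrix.of_apply]
  -- Factors `√p` are inserted so that `ψ` appears only as `p^{-1/2} ψ`, the form produced by `e1`,
  -- `e2` and `e3`.
  have e4 : ∀ j, (D.ψ j (D.ξ ω) (D.z i ω) + D.σx * D.e i j ω)
        * (D.ψ j (D.ξ ω) (D.z i' ω) + D.σx * D.e i' j ω)
      = p * ((√(p : ℝ))⁻¹ * D.ψ j (D.ξ ω) (D.z i' ω) * ((√(p : ℝ))⁻¹ * D.ψ j (D.ξ ω) (D.z i ω)))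
        + √(p : ℝ) * D.σx * ((√(p : ℝ))⁻¹ * D.ψ j (D.ξ ω) (D.z i ω) * D.e i' j ω)
        + √(p : ℝ) * D.σx * (D.e i j ω * ((√(p : ℝ))⁻¹ * D.ψ j (D.ξ ω) (D.z i' ω)))
        + D.σx ^ 2 * (D.e i j ω * D.e i' j ω) := by
    intro j
    generalize √(p : ℝ) = q at hs hs0 ⊢
    rw [← hs]
    field_simp
    ring
  simp_rw [e4]
  rw [Finset.sum_add_distrib, Finset.sum_add_distrib, Finset.sum_add_distrib, ← Finset.mul_sum,
    ← Finset.mul_sum, ← Finset.mul_sum, ← Finset.mul_sum]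
  have e5 : (p : ℝ)⁻¹ * √(p : ℝ) = (√(p : ℝ))⁻¹ := by
    generalize √(p : ℝ) = q at hs hs0 ⊢
    rw [← hs]; field_simp
  simp only [mul_add, mul_sub, ← mul_assoc, e5]
  rw [inv_mul_cancel₀ hp0, mul_right_comm _ _ (p : ℝ), inv_mul_cancel₀ hp0]
  ring

/-- In this form each summand is a function of the test position times a coordinate of `A⁻¹ y`; it
serves both to split the prediction error and to prove square integrability. -/
lemma gramError_eq (hφ : ∀ z, Summable fun k => featureMap lam u z k ^ 2) (γ : ℝ) (g : Z → ℝ)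
    {ω : Ω} (h : D.HasExpansions lam u μ ω) :
    D.gramError lam u μ γ g ω = ∑ i, (∑ j, (√(p : ℝ))⁻¹ * D.ψ j (D.ξ ω) (D.z i ω) *
        ((√(p : ℝ))⁻¹ * D.ψ j (D.ξ ω) (D.zTest ω)) - seqDot (D.φTest lam u ω) (D.Φ lam u ω i))
          * ((D.A γ ω)⁻¹ *ᵥ D.y g ω) i :=
  (HasDot.sum fun i => hasDot_seqVecMul_WtWsubI (fun j => (h j).1) (fun j => (h j).2 i)
    (hasDot_of_summable_sq (hφ _) (hφ _))).seqDot_eq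

lemma noiseError_eq (γ : ℝ) (g : Z → ℝ) {ω : Ω} (h : D.HasExpansions lam u μ ω) :
    D.noiseError lam u μ γ g ω = ∑ i, (∑ j, (√(p : ℝ))⁻¹ * D.ψ j (D.ξ ω) (D.zTest ω) * D.e i j ω)
      * ((D.A γ ω)⁻¹ *ᵥ D.y g ω) i := by
  have e : seqVecMul (D.φTest lam u ω) (D.W lam u μ ω)ᵀ
      = fun j => (√(p : ℝ))⁻¹ * D.ψ j (D.ξ ω) (D.zTest ω) := by
    ext j; exact (h j).1.seqDot_eq
  rw [noiseError, e, dotProduct_mulVec]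
  rfl

/-- In `x_testᵀ x_i`, the product of the two `ψ` parts less the feature product gives the Gram
error, `ψ(z_test)` against `σx e_i` the noise error, and `σx e_test` against the whole of `x_i` the
test noise error. -/
lemma predError_eq_sum (hp : 1 ≤ p) (hφ : ∀ z, Summable fun k => featureMap lam u z k ^ 2)
    {g : Z → ℝ} {θ : ℕ → ℝ} (hg : ∀ z, g z = seqDot (featureMap lam u z) θ) (γ : ℝ) {ω : Ω}
    (h : D.HasExpansions lam u μ ω) :
    D.predError γ g ω = D.ridgeError lam u γ g θ ω + D.gramError lam u μ γ g ω
      + (√(p : ℝ))⁻¹ * D.σx * D.noiseError lam u μ γ g ω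
      + (p : ℝ)⁻¹ * D.σx * D.testNoiseError γ g ω := by
  have hs : √(p : ℝ) * √(p : ℝ) = p := Real.mul_self_sqrt (Nat.cast_nonneg p)
  have hs0 : √(p : ℝ) ≠ 0 := by positivity
  rw [predError_eq hφ hg, gramError_eq hφ γ g h, noiseError_eq γ g h, testNoiseError_eq]
  have e : ((p : ℝ)⁻¹ • (D.xTest ω ᵥ* (D.X ω)ᵀ) - seqVecMul (D.φTest lam u ω) (D.Φ lam u ω)ᵀ)
          ⬝ᵥ ((D.A γ ω)⁻¹ *ᵥ D.y g ω)
      = ∑ i, ((p : ℝ)⁻¹ * ∑ j, D.xTest ω j * D.X ω i j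
        - seqDot (D.φTest lam u ω) (D.Φ lam u ω i)) * ((D.A γ ω)⁻¹ *ᵥ D.y g ω) i := rfl
  rw [e, ridgeError, add_assoc, add_assoc]
  congr 1
  rw [Finset.mul_sum, Finset.mul_sum, ← Finset.sum_add_distrib, ← Finset.sum_add_distrib]
  refine Finset.sum_congr rfl fun i _ => ?_
  have e2 : (p : ℝ)⁻¹ * ∑ j, D.xTest ω j * D.X ω i j
      = ∑ j, (√(p : ℝ))⁻¹ * D.ψ j (D.ξ ω) (D.z i ω) * ((√(p : ℝ))⁻¹ * D.ψ j (D.ξ ω) (D.zTest ω))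
        + (√(p : ℝ))⁻¹ * D.σx * ∑ j, (√(p : ℝ))⁻¹ * D.ψ j (D.ξ ω) (D.zTest ω) * D.e i j ω
        + (p : ℝ)⁻¹ * D.σx * ∑ j, D.eTest j ω * D.X ω i j := by
    rw [Finset.mul_sum, Finset.mul_sum, Finset.mul_sum, ← Finset.sum_add_distrib,
      ← Finset.sum_add_distrib]
    refine Finset.sum_congr rfl fun j _ => ?_
    simp only [xTest, X, Matrix.of_apply]
    clear h e
    generalize √(p : ℝ) = q at hs hs0 ⊢
    rw [← hs]
    field_simp
  rw [e2]
  ring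

end LatentData

/-! ### Second moments under independence -/

section SecondMoments

variable {Ω : Type*} [MeasurableSpace Ω] {P : Measure Ω}

lemma lintegral_ofReal_abs_sq_lt_top {f : Ω → ℝ} (hf : MemLp f 2 P) :
    ∫⁻ ω, ENNReal.ofReal (|f ω| ^ 2) ∂P < ∞ := by
  simp only [sq_abs]
  exact hf.integrable_sq.lintegral_lt_top

/-- The squares of independent factors are independent and integrable, so their product is
integrable; without independence, Hölder would only give an integrable product. -/
lemma memLp_sum_mul_of_indepFun {α β ι : Type*} [MeasurableSpace α]
    [MeasurableSpace β] [Fintype ι] {X : Ω → α} {Y : Ω → β} (hXY : IndepFun X Y P)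
    {f : ι → α → ℝ} {g : ι → β → ℝ} (hf : ∀ i, Measurable (f i)) (hg : ∀ i, Measurable (g i))
    (hfX : ∀ i, MemLp (fun ω => f i (X ω)) 2 P) (hgY : ∀ i, MemLp (fun ω => g i (Y ω)) 2 P) :
    MemLp (fun ω => ∑ i, f i (X ω) * g i (Y ω)) 2 P := by
  refine memLp_finsetSum _ fun i _ => ?_
  refine (memLp_two_iff_integrable_sq ((hfX i).1.mul (hgY i).1)).2 ?_
  have h := (hXY.comp ((hf i).pow_const 2) ((hg i).pow_const 2)).integrable_mul
    (hfX i).integrable_sq (hgY i).integrable_sq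
  refine h.congr (Eventually.of_forall fun ω => ?_)
  simp [mul_pow]

lemma comap_pi_le {α ι : Type*} {m : MeasurableSpace α} {f : α → ι → ℝ}
    (h : ∀ i, MeasurableSpace.comap (fun a => f a i) inferInstance ≤ m) :
    MeasurableSpace.comap f MeasurableSpace.pi ≤ m :=
  measurable_iff_comap_le.1 (measurable_pi_lambda _ fun i => measurable_iff_comap_le.2 (h i))

/-- The second moment of a random linear combination of orthogonal random variables, with
independent random coefficients `v k + w k`, `w k` centered. -/
lemma lintegral_sq_sum_eq [IsProbabilityMeasure P] {φ w : ℕ → Ω → ℝ} {lam v : ℕ → ℝ}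
    (hφ : ∀ k, MemLp (φ k) 2 P)
    (hlam : ∀ k l, ∫ ω, φ k ω * φ l ω ∂P = if k = l then lam k else 0) (h0 : ∀ k, 0 ≤ lam k)
    (hw : ∀ k, MemLp (w k) 2 P) (hw0 : ∀ k, ∫ ω, w k ω ∂P = 0)
    (hind : ∀ k l, IndepFun (fun ω => φ k ω * φ l ω)
      (fun ω => (v k + w k ω) * (v l + w l ω)) P) (r : ℕ) :
    ∫⁻ ω, ENNReal.ofReal (|∑ k ∈ Finset.range r, φ k ω * (v k + w k ω)| ^ 2) ∂P
      = ∑ k ∈ Finset.range r, (ENNReal.ofReal (lam k * v k ^ 2)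
        + ∫⁻ ω, ENNReal.ofReal (lam k * w k ω ^ 2) ∂P) := by
  have hvw : ∀ k, MemLp (fun ω => v k + w k ω) 2 P := fun k => (memLp_const (v k)).add (hw k)
  have hφφ : ∀ k l, Integrable (fun ω => φ k ω * φ l ω) P :=
    fun k l => (hφ k).integrable_mul (hφ l)
  have hww : ∀ k l, Integrable (fun ω => (v k + w k ω) * (v l + w l ω)) P :=
    fun k l => (hvw k).integrable_mul (hvw l)
  have hI : ∀ k l, Integrable
      (fun ω => (φ k ω * φ l ω) * ((v k + w k ω) * (v l + w l ω))) P :=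
    fun k l => (hind k l).integrable_mul (hφφ k l) (hww k l)
  have hexp : ∀ ω, |∑ k ∈ Finset.range r, φ k ω * (v k + w k ω)| ^ 2
      = ∑ k ∈ Finset.range r, ∑ l ∈ Finset.range r,
        (φ k ω * φ l ω) * ((v k + w k ω) * (v l + w l ω)) := by
    intro ω
    rw [sq_abs, pow_two, Finset.sum_mul_sum]
    exact Finset.sum_congr rfl fun k _ => Finset.sum_congr rfl fun l _ => by ring
  have hsq : ∀ k, ∫ ω, (v k + w k ω) * (v k + w k ω) ∂P = v k ^ 2 + ∫ ω, w k ω ^ 2 ∂P := by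
    intro k
    have hwi : Integrable (w k) P := (hw k).integrable (by norm_num)
    have e : ∀ ω, (v k + w k ω) * (v k + w k ω) = (v k ^ 2 + 2 * v k * w k ω) + w k ω ^ 2 :=
      fun ω => by ring
    have hi : Integrable (fun ω => 2 * v k * w k ω) P := hwi.const_mul _
    have hi' : Integrable (fun ω => v k ^ 2 + 2 * v k * w k ω) P := (integrable_const _).add hi
    simp_rw [e]
    rw [integral_add hi' (hw k).integrable_sq, integral_add (integrable_const _) hi,
      integral_const_mul, hw0]
    simp
  have hint : Integrable (fun ω => ∑ k ∈ Finset.range r, ∑ l ∈ Finset.range r,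
        (φ k ω * φ l ω) * ((v k + w k ω) * (v l + w l ω))) P :=
    integrable_finsetSum _ fun k _ => integrable_finsetSum _ fun l _ => hI k l
  simp_rw [hexp]
  rw [← ofReal_integral_eq_lintegral_ofReal hint
    (Eventually.of_forall fun ω => (sq_nonneg _).trans_eq (hexp ω)),
    integral_finsetSum _ fun k _ => integrable_finsetSum _ fun l _ => hI k l]
  -- Independence factors every term, and those with `l ≠ k` vanish by orthogonality of the `φ`.
  have hterm : ∀ k ∈ Finset.range r, ∫ ω, ∑ l ∈ Finset.range r,
        (φ k ω * φ l ω) * ((v k + w k ω) * (v l + w l ω)) ∂P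
      = lam k * (v k ^ 2 + ∫ ω, w k ω ^ 2 ∂P) := by
    intro k hk
    rw [integral_finsetSum _ fun l _ => hI k l, Finset.sum_eq_single_of_mem k hk]
    · rw [(hind k k).integral_fun_mul_eq_mul_integral (hφφ k k).1 (hww k k).1, hlam, hsq, if_pos rfl]
    · intro l _ hl
      rw [(hind k l).integral_fun_mul_eq_mul_integral (hφφ k l).1 (hww k l).1, hlam,
        if_neg hl.symm, zero_mul]
  have hnn : ∀ k, 0 ≤ ∫ ω, w k ω ^ 2 ∂P := fun k => integral_nonneg fun ω => sq_nonneg _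
  rw [Finset.sum_congr rfl hterm, ENNReal.ofReal_sum_of_nonneg
    fun k _ => mul_nonneg (h0 k) (add_nonneg (sq_nonneg _) (hnn k))]
  refine Finset.sum_congr rfl fun k _ => ?_
  rw [mul_add, ENNReal.ofReal_add (mul_nonneg (h0 k) (sq_nonneg _)) (mul_nonneg (h0 k) (hnn k)),
    ← integral_const_mul, ofReal_integral_eq_lintegral_ofReal ((hw k).integrable_sq.const_mul _)
      (Eventually.of_forall fun ω => mul_nonneg (h0 k) (sq_nonneg _))]

end SecondMoments

/-! ### Bias and variance: finiteness and the bound on the ridge error. -/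

lemma lamNormSq_le {lam : ℕ → ℝ} (hlam : Antitone lam) (h0 : ∀ k, 0 ≤ lam k) {v : ℕ → ℝ} {M : ℝ}
    (hv : ∀ r, ∑ k ∈ Finset.range r, v k ^ 2 ≤ M) :
    lamNormSq lam v ≤ ENNReal.ofReal (lam 0 * M) := by
  refine ENNReal.tsum_le_of_sum_range_le fun r => ?_
  rw [← ENNReal.ofReal_sum_of_nonneg fun k _ => mul_nonneg (h0 k) (sq_nonneg _)]
  refine ENNReal.ofReal_le_ofReal ?_
  calc ∑ k ∈ Finset.range r, lam k * v k ^ 2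
      ≤ ∑ k ∈ Finset.range r, lam 0 * v k ^ 2 :=
        Finset.sum_le_sum fun k _ => mul_le_mul_of_nonneg_right (hlam (Nat.zero_le k)) (sq_nonneg _)
    _ ≤ lam 0 * M := by
        rw [← Finset.mul_sum]
        exact mul_le_mul_of_nonneg_left (hv r) (h0 0)

namespace LatentData

variable {Ω Ξ Z : Type*} {n p : ℕ} {D : LatentData Ω Ξ Z n p} {lam : ℕ → ℝ} {u : ℕ → Z → ℝ}

/-- Cauchy-Schwarz over the training points; each of the `n` rows of `Φ` has squared norm at most
`C`. -/
lemma sum_thetaHat_sq_le {C : ℝ}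
    (hφC : ∀ z r, ∑ k ∈ Finset.range r, featureMap lam u z k ^ 2 ≤ C) (γ : ℝ) (ω : Ω)
    (y : Fin n → ℝ) (r : ℕ) :
    ∑ k ∈ Finset.range r, D.thetaHat lam u γ ω y k ^ 2
      ≤ n * C * ∑ i, ((D.A γ ω)⁻¹ *ᵥ y) i ^ 2 := by
  calc ∑ k ∈ Finset.range r, D.thetaHat lam u γ ω y k ^ 2
      ≤ ∑ k ∈ Finset.range r, (∑ i, D.Φ lam u ω i k ^ 2) * ∑ i, ((D.A γ ω)⁻¹ *ᵥ y) i ^ 2 :=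
        Finset.sum_le_sum fun k _ => Finset.sum_mul_sq_le_sq_mul_sq Finset.univ
          (fun i => D.Φ lam u ω i k) fun i => ((D.A γ ω)⁻¹ *ᵥ y) i
    _ = (∑ i, ∑ k ∈ Finset.range r, D.Φ lam u ω i k ^ 2) * ∑ i, ((D.A γ ω)⁻¹ *ᵥ y) i ^ 2 := by
        rw [← Finset.sum_mul, Finset.sum_comm]
    _ ≤ n * C * ∑ i, ((D.A γ ω)⁻¹ *ᵥ y) i ^ 2 := by
        refine mul_le_mul_of_nonneg_right ?_ (Finset.sum_nonneg fun i _ => sq_nonneg _)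
        refine (Finset.sum_le_sum fun i _ => hφC (D.z i ω) r).trans ?_
        simp

lemma B_lt_top (hlam : Antitone lam) (h0 : ∀ k, 0 ≤ lam k) {C : ℝ}
    (hφC : ∀ z r, ∑ k ∈ Finset.range r, featureMap lam u z k ^ 2 ≤ C) {θ : ℕ → ℝ}
    (hθ : Summable fun k => θ k ^ 2) (γ : ℝ) (ω : Ω) : D.B lam u γ θ ω < ∞ := by
  set y : Fin n → ℝ := fun i => seqDot (D.Φ lam u ω i) θ
  refine (lamNormSq_le hlam h0 (M := 2 * (n * C * ∑ i, ((D.A γ ω)⁻¹ *ᵥ y) i ^ 2)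
    + 2 * ∑' k, θ k ^ 2) fun r => ?_).trans_lt ENNReal.ofReal_lt_top
  calc ∑ k ∈ Finset.range r, (D.thetaHat lam u γ ω y - θ) k ^ 2
      ≤ ∑ k ∈ Finset.range r, (2 * D.thetaHat lam u γ ω y k ^ 2 + 2 * θ k ^ 2) := by
        refine Finset.sum_le_sum fun k _ => ?_
        rw [Pi.sub_apply]
        nlinarith [sq_nonneg (D.thetaHat lam u γ ω y k + θ k)]
    _ ≤ _ := by
        rw [Finset.sum_add_distrib, ← Finset.mul_sum, ← Finset.mul_sum]
        gcongr
        · exact sum_thetaHat_sq_le hφC γ ω y r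
        · exact hθ.sum_le_tsum _ fun k _ => sq_nonneg _

lemma thetaHat_add (γ : ℝ) (ω : Ω) (y y' : Fin n → ℝ) (k : ℕ) :
    D.thetaHat lam u γ ω (y + y') k
      = D.thetaHat lam u γ ω y k + D.thetaHat lam u γ ω y' k := by
  simp only [thetaHat, Matrix.mulVec_add, Pi.add_apply]

variable [MeasurableSpace Ω] [MeasurableSpace Ξ] [MeasurableSpace Z] {P : Measure Ω}
  {μ : Measure Z} {g : Z → ℝ}

lemma IsLatentMetricModel.indepFun_zTest_epsVec (hD : D.IsLatentMetricModel P μ) :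
    IndepFun D.zTest D.epsVec P := by
  have h := hD.indep_sigmaOf (S := srcZTest n p) (T := srcEps n p) (by
    rw [Set.disjoint_left]; rintro s rfl ⟨i, hi⟩; cases hi)
  refine indep_of_indep_of_le_left (indep_of_indep_of_le_right h ?_) ?_
  · exact comap_pi_le fun i =>
      le_iSup₂_of_le (f := fun s (_ : s ∈ srcEps n p) => D.sigma s) (.eps i) ⟨i, rfl⟩ le_rfl
  · exact le_iSup₂_of_le (f := fun s (_ : s ∈ srcZTest n p) => D.sigma s) .zTest rfl le_rfl

lemma IsLatentMetricModel.indepFun_eTest_epsVec (hD : D.IsLatentMetricModel P μ) :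
    IndepFun (fun ω j => D.eTest j ω) D.epsVec P := by
  have h := hD.indep_sigmaOf (S := srcETest n p) (T := srcEps n p) (by
    rw [Set.disjoint_left]; rintro s ⟨j, rfl⟩ ⟨i, hi⟩; cases hi)
  refine indep_of_indep_of_le_left (indep_of_indep_of_le_right h ?_) ?_
  · exact comap_pi_le fun i =>
      le_iSup₂_of_le (f := fun s (_ : s ∈ srcEps n p) => D.sigma s) (.eps i) ⟨i, rfl⟩ le_rfl
  · exact comap_pi_le fun j =>
      le_iSup₂_of_le (f := fun s (_ : s ∈ srcETest n p) => D.sigma s) (.eTest j) ⟨j, rfl⟩ le_rfl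

variable [IsProbabilityMeasure P]

lemma IsLatentMetricModel.memLp_mulVec_eps (hD : D.IsLatentMetricModel P μ)
    (M : Matrix (Fin n) (Fin n) ℝ) (c : Fin n → ℝ) (i : Fin n) :
    MemLp (fun ω => (M *ᵥ (c + D.epsVec ω)) i) 2 P := by
  have e : (fun ω => (M *ᵥ (c + D.epsVec ω)) i)
      = fun ω => ∑ l, M i l * (c l + D.eps l ω) := rfl
  have h : ∀ l, MemLp (fun ω => c l + D.eps l ω) 2 P := fun l =>
    (memLp_const (c l)).add (hD.memLp_eps l)
  rw [e]
  exact memLp_finsetSum _ fun l _ => (h l).const_mul (M i l)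

lemma measurable_mulVec_add (M : Matrix (Fin n) (Fin n) ℝ) (c : Fin n → ℝ) (i : Fin n) :
    Measurable fun e : Fin n → ℝ => (M *ᵥ (c + e)) i :=
  measurable_mulVec (M := fun _ => M) (v := fun e => c + e) (fun _ _ => measurable_const)
    (fun l => show Measurable fun e : Fin n → ℝ => c l + e l by fun_prop) i

lemma lintegral_lamNormSq_lt_top (hD : D.IsLatentMetricModel P μ) (hlam : Antitone lam)
    (h0 : ∀ k, 0 ≤ lam k) {C : ℝ}
    (hφC : ∀ z r, ∑ k ∈ Finset.range r, featureMap lam u z k ^ 2 ≤ C) (γ : ℝ) (ω : Ω) :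
    ∫⁻ ω', lamNormSq lam
      ((D.freezeTrain ω).thetaHat lam u γ ω' ((D.freezeTrain ω).epsVec ω')) ∂P < ∞ := by
  have hm : ∀ i, MemLp (fun ω' => ((D.A γ ω)⁻¹ *ᵥ D.epsVec ω') i) 2 P := fun i => by
    simpa using hD.memLp_mulVec_eps ((D.A γ ω)⁻¹) 0 i
  have hI : Integrable (fun ω' => lam 0 * (n * C * ∑ i, ((D.A γ ω)⁻¹ *ᵥ D.epsVec ω') i ^ 2)) P :=
    ((integrable_finsetSum _ fun i _ => (hm i).integrable_sq).const_mul _).const_mul _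
  refine lt_of_le_of_lt (lintegral_mono fun ω' => ?_) hI.lintegral_lt_top
  exact lamNormSq_le hlam h0 (sum_thetaHat_sq_le hφC γ ω' _)

/-- The error is `∑ φ_k(z_test) (v_k + w_k)` with deterministic bias `v = θ̂(Φθ) - θ` and centered
`w = θ̂(ε)` independent of `z_test`. Partial sums have as second moments exactly the partial sums of
the series for `B` and `V`; Fatou's lemma gives the inequality in the limit. -/
lemma lintegral_ridgeError_le (hD : D.IsLatentMetricModel P μ) {κ : Z → Z → ℝ}
    (hu : IsEigensystem μ κ lam u) (hφm : ∀ k, Measurable fun z => featureMap lam u z k)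
    {C : ℝ}
    (hφC : ∀ z r, ∑ k ∈ Finset.range r, featureMap lam u z k ^ 2 ≤ C) {θ : ℕ → ℝ}
    (hθ : Summable fun k => θ k ^ 2) (hg : ∀ z, g z = seqDot (featureMap lam u z) θ) (γ : ℝ)
    (ω : Ω) :
    ∫⁻ ω', ENNReal.ofReal (|(D.freezeTrain ω).ridgeError lam u γ g θ ω'| ^ 2) ∂P
      ≤ D.B lam u γ θ ω + ∫⁻ ω', lamNormSq lam
        ((D.freezeTrain ω).thetaHat lam u γ ω' ((D.freezeTrain ω).epsVec ω')) ∂P := by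
  have hφs : ∀ z, Summable fun k => featureMap lam u z k ^ 2 := fun z =>
    summable_of_sum_range_le (fun k => sq_nonneg _) (hφC z)
  set c : Fin n → ℝ := fun i => seqDot (D.Φ lam u ω i) θ with hc
  set v : ℕ → ℝ := D.thetaHat lam u γ ω c - θ with hv
  set w : ℕ → Ω → ℝ := fun k ω' => D.thetaHat lam u γ ω (D.epsVec ω') k with hw
  set φ : ℕ → Ω → ℝ := fun k ω' => featureMap lam u (D.zTest ω') k with hφ
  have hwm : ∀ k, Measurable fun e : Fin n → ℝ => D.thetaHat lam u γ ω e k := fun k =>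
    measurable_mulVec (M := fun _ => (D.Φ lam u ω)ᵀ) (fun _ _ => measurable_const)
      (measurable_mulVec (M := fun _ => (D.A γ ω)⁻¹) (fun _ _ => measurable_const)
        measurable_pi_apply) k
  have hweq : ∀ k, ∃ (a : Fin n → ℝ) (N : Fin n → Fin n → ℝ),
      w k = fun ω' => ∑ i, a i * ∑ l, N i l * D.eps l ω' := fun k =>
    ⟨fun i => D.Φ lam u ω i k, fun i l => (D.A γ ω)⁻¹ i l, rfl⟩
  have hwL : ∀ k, MemLp (w k) 2 P := fun k => by
    obtain ⟨a, N, e⟩ := hweq k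
    rw [e]
    exact memLp_finsetSum _ fun i _ => (memLp_finsetSum _ fun l _ =>
      (hD.memLp_eps l).const_mul _).const_mul _
  have hepsI : ∀ l, Integrable (D.eps l) P := fun l => (hD.memLp_eps l).integrable (by norm_num)
  have hw0 : ∀ k, ∫ ω', w k ω' ∂P = 0 := fun k => by
    obtain ⟨a, N, e⟩ := hweq k
    simp only [e]
    rw [integral_finsetSum _ fun i _ => (integrable_finsetSum _ fun l _ =>
      (hepsI l).const_mul _).const_mul _]
    refine Finset.sum_eq_zero fun i _ => ?_
    rw [integral_const_mul, integral_finsetSum _ fun l _ => (hepsI l).const_mul _]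
    simp [integral_const_mul, hD.mean_eps]
  have hpres : MeasurePreserving D.zTest P μ := ⟨hD.measurable_zTest, hD.law_zTest⟩
  have hφL : ∀ k, MemLp (φ k) 2 P := fun k => by
    have : MemLp (fun z => featureMap lam u z k) 2 μ := by
      simp only [featureMap_eq_posEigen hu.nonneg]
      exact (hu.memLp_posEigen k).const_mul _
    exact this.comp_measurePreserving hpres
  have hφφ : ∀ k l, ∫ ω', φ k ω' * φ l ω' ∂P = if k = l then lam k else 0 := by
    intro k l
    have e1 : ∫ ω', φ k ω' * φ l ω' ∂P = ∫ z, featureMap lam u z k * featureMap lam u z l ∂μ := by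
      rw [← hD.law_zTest]
      exact (integral_map hD.measurable_zTest.aemeasurable
        (f := fun z => featureMap lam u z k * featureMap lam u z l)
        ((hφm k).mul (hφm l)).aestronglyMeasurable).symm
    have e2 : ∀ z, featureMap lam u z k * featureMap lam u z l
        = √(lam k) * √(lam l) * (posEigen lam u k z * posEigen lam u l z) := fun z => by
      rw [featureMap_eq_posEigen hu.nonneg, featureMap_eq_posEigen hu.nonneg]
      ring
    rw [e1]
    simp_rw [e2]
    rw [integral_const_mul, hu.integral_posEigen_mul]
    by_cases hkl : k = l
    · subst hkl
      rw [Real.mul_self_sqrt (hu.nonneg k)]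
      by_cases hk : 0 < lam k
      · simp [hk]
      · simp [le_antisymm (not_lt.1 hk) (hu.nonneg k)]
    · simp [hkl]
  have hind : ∀ k l, IndepFun (fun ω' => φ k ω' * φ l ω')
      (fun ω' => (v k + w k ω') * (v l + w l ω')) P := fun k l =>
    hD.indepFun_zTest_epsVec.comp (φ := fun z => featureMap lam u z k * featureMap lam u z l)
      (ψ := fun e => (v k + D.thetaHat lam u γ ω e k) * (v l + D.thetaHat lam u γ ω e l))
      ((hφm k).mul (hφm l)) (((hwm k).const_add _).mul ((hwm l).const_add _))
  -- The responses are `y = Φθ + ε`, so by linearity `θ̂(y) - θ = v + w`.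
  have hlim : ∀ ω', Tendsto (fun r : ℕ => ENNReal.ofReal
      (|∑ k ∈ Finset.range r, φ k ω' * (v k + w k ω')| ^ 2)) atTop
      (𝓝 (ENNReal.ofReal (|(D.freezeTrain ω).ridgeError lam u γ g θ ω'| ^ 2))) := by
    intro ω'
    have hy : (D.freezeTrain ω).y g ω' = c + D.epsVec ω' := by
      ext i
      change g (D.z i ω) + _ = _
      rw [hg]
      rfl
    have h1 : HasDot (featureMap lam u (D.zTest ω'))
        (D.thetaHat lam u γ ω ((D.freezeTrain ω).y g ω'))
        (seqDot (featureMap lam u (D.zTest ω'))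
          (D.thetaHat lam u γ ω ((D.freezeTrain ω).y g ω'))) := by
      have := hasDot_thetaHat (D := D) hφs (hφs (D.zTest ω')) γ ω ((D.freezeTrain ω).y g ω')
      rwa [this.seqDot_eq]
    have h2 := h1.sub (hasDot_of_summable_sq (hφs (D.zTest ω')) hθ)
    have h3 : HasDot (featureMap lam u (D.zTest ω')) (fun k => v k + w k ω')
        ((D.freezeTrain ω).ridgeError lam u γ g θ ω') := by
      refine (Eq.mp ?_ h2 : _)
      congr 1
      ext k
      rw [hy, thetaHat_add]
      simp only [hv, hw, Pi.sub_apply]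
      ring
    exact ENNReal.tendsto_ofReal ((Tendsto.abs h3).pow 2)
  have hmeas : ∀ r : ℕ, Measurable fun ω' => ENNReal.ofReal
      (|∑ k ∈ Finset.range r, φ k ω' * (v k + w k ω')| ^ 2) := fun r => by
    have hw' : ∀ k, Measurable (w k) := fun k =>
      (hwm k).comp (measurable_pi_lambda _ hD.measurable_eps)
    exact ((Finset.measurable_fun_sum _ fun k _ => ((hφm k).comp hD.measurable_zTest).mul
      ((hw' k).const_add _)).abs.pow_const 2).ennreal_ofReal
  calc ∫⁻ ω', ENNReal.ofReal (|(D.freezeTrain ω).ridgeError lam u γ g θ ω'| ^ 2) ∂P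
      = ∫⁻ ω', liminf (fun r : ℕ => ENNReal.ofReal
          (|∑ k ∈ Finset.range r, φ k ω' * (v k + w k ω')| ^ 2)) atTop ∂P :=
        lintegral_congr fun ω' => (hlim ω').liminf_eq.symm
    _ ≤ liminf (fun r : ℕ => ∫⁻ ω', ENNReal.ofReal
          (|∑ k ∈ Finset.range r, φ k ω' * (v k + w k ω')| ^ 2) ∂P) atTop :=
        lintegral_liminf_le hmeas
    _ ≤ _ := by
        refine liminf_le_of_le (by isBoundedDefault) fun b hb => ?_
        obtain ⟨r, hr⟩ := hb.exists
        refine hr.trans ?_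
        rw [lintegral_sq_sum_eq hφL hφφ hu.nonneg hwL hw0 hind, Finset.sum_add_distrib]
        refine add_le_add (ENNReal.sum_le_tsum _) ?_
        have e : ∫⁻ ω', lamNormSq lam ((D.freezeTrain ω).thetaHat lam u γ ω'
            ((D.freezeTrain ω).epsVec ω')) ∂P
            = ∑' k, ∫⁻ ω', ENNReal.ofReal (lam k * w k ω' ^ 2) ∂P :=
          lintegral_tsum fun k => (((hwL k).1.aemeasurable.pow_const 2).const_mul _).ennreal_ofReal
        rw [e]
        exact ENNReal.sum_le_tsum _

end LatentData

/-! ### Consequences of the model assumptions -/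

/-- An event of two independent variables occurs almost surely if it does for almost every value
of the second one, almost surely in the first one. -/
lemma ae_of_ae_ae_of_indepFun {Ω α β : Type*} [MeasurableSpace Ω] [MeasurableSpace α]
    [MeasurableSpace β] {P : Measure Ω} [IsProbabilityMeasure P] {X : Ω → α} {Y : Ω → β}
    (hX : Measurable X) (hY : Measurable Y) (hXY : IndepFun X Y P) {G : α → β → Prop}
    (hG : MeasurableSet {q : α × β | G q.1 q.2}) (h : ∀ᵐ ω ∂P, ∀ᵐ ω' ∂P, G (X ω) (Y ω')) :
    ∀ᵐ ω ∂P, G (X ω) (Y ω) := by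
  have hm : Measurable ({q : α × β | G q.1 q.2}ᶜ.indicator (1 : α × β → ℝ≥0∞)) :=
    measurable_one.indicator hG.compl
  have h1 := lintegral_lintegral_of_indepFun hX hY hXY hm
  have h2 : ∫⁻ ω, ∫⁻ ω', {q : α × β | G q.1 q.2}ᶜ.indicator (1 : α × β → ℝ≥0∞) (X ω, Y ω') ∂P ∂P
      = 0 := by
    refine (lintegral_congr_ae ?_).trans lintegral_zero
    filter_upwards [h] with ω hω
    refine (lintegral_congr_ae ?_).trans lintegral_zero
    filter_upwards [hω] with ω' hω'
    simp [hω']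
  rw [h2] at h1
  have h3 := (lintegral_eq_zero_iff (hm.comp (hX.prodMk hY))).1 h1.symm
  filter_upwards [h3] with ω hω
  by_contra hc
  simp [hc] at hω

namespace LatentData

variable {Ω Ξ Z : Type*} {n p : ℕ} {D : LatentData Ω Ξ Z n p} {lam : ℕ → ℝ}
  {u : ℕ → Z → ℝ}

/-- The factor `√λ_k` of the feature cancels the `λ_k^{-1/2}` in `W`, and the terms with `λ_k = 0`
vanish on both sides; the two series differ by the factor `p^{-1/2}` only. -/
lemma hasDot_W_iff [MeasurableSpace Z] {μ : Measure Z} (h0 : ∀ k, 0 ≤ lam k) (hp : 1 ≤ p) (ω : Ω) (j : Fin p) (z : Z) :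
    HasDot (featureMap lam u z) (D.W lam u μ ω j) ((√(p : ℝ))⁻¹ * D.ψ j (D.ξ ω) z) ↔
      Tendsto (fun r : ℕ => ∑ k ∈ Finset.range r,
        (∫ z, D.ψ j (D.ξ ω) z * posEigen lam u k z ∂μ) * posEigen lam u k z) atTop
        (𝓝 (D.ψ j (D.ξ ω) z)) := by
  have hp0 : (√(p : ℝ))⁻¹ ≠ 0 := by positivity
  have e : ∀ k, featureMap lam u z k * D.W lam u μ ω j k = (√(p : ℝ))⁻¹ *
      ((∫ z, D.ψ j (D.ξ ω) z * posEigen lam u k z ∂μ) * posEigen lam u k z) := by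
    intro k
    by_cases hk : 0 < lam k
    · have hs : √(lam k) ≠ 0 := (Real.sqrt_pos.2 hk).ne'
      simp only [featureMap, W, Matrix.of_apply, if_neg hk.ne', posEigen_of_pos hk]
      rw [Real.sqrt_mul (h0 k), mul_inv]
      field_simp
    · simp [featureMap_eq_posEigen h0, posEigen_of_not_pos hk]
  simp only [HasDot, e, ← Finset.mul_sum]
  exact tendsto_const_smul_iff₀ (c := (√(p : ℝ))⁻¹) hp0

variable [MeasurableSpace Ω] {P : Measure Ω}

/-- Mean-square continuity bounds the second moment near each point, and compactness makes the bound
uniform. -/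
lemma IsMeanSquareContinuous.exists_bound [TopologicalSpace Z] [CompactSpace Z]
    (hψ : D.IsMeanSquareContinuous P) :
    ∃ C : ℝ, ∀ j z, ∫ ω, D.ψ j (D.ξ ω) z ^ 2 ∂P ≤ C := by
  have hone : ∀ j, ∃ C : ℝ, ∀ z ∈ (Set.univ : Set Z), ∫ ω, D.ψ j (D.ξ ω) z ^ 2 ∂P ≤ C := by
    intro j
    refine isCompact_univ.induction_on (p := fun s : Set Z =>
      ∃ C : ℝ, ∀ z ∈ s, ∫ ω, D.ψ j (D.ξ ω) z ^ 2 ∂P ≤ C) ⟨0, fun z hz => hz.elim⟩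
      (fun s t hst ⟨C, hC⟩ => ⟨C, fun z hz => hC z (hst hz)⟩)
      (fun s t ⟨C, hC⟩ ⟨C', hC'⟩ => ⟨max C C', ?_⟩) fun z _ => ?_
    · rintro z (hz | hz)
      · exact (hC z hz).trans (le_max_left _ _)
      · exact (hC' z hz).trans (le_max_right _ _)
    -- The bound comes from `b² ≤ 2 a² + 2 (a - b)²` where the mean-square distance to `z` is below
    -- `1`.
    · refine ⟨{z' | ∫ ω, |D.ψ j (D.ξ ω) z - D.ψ j (D.ξ ω) z'| ^ 2 ∂P < 1},
        mem_nhdsWithin_of_mem_nhds ((hψ.continuous j z).eventually_lt_const one_pos),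
        2 * ∫ ω, D.ψ j (D.ξ ω) z ^ 2 ∂P + 2 * 1, fun z' hz' => ?_⟩
      have hd : Integrable (fun ω => |D.ψ j (D.ξ ω) z - D.ψ j (D.ξ ω) z'| ^ 2) P := by
        simp only [sq_abs]
        exact ((hψ.memLp j z).sub (hψ.memLp j z')).integrable_sq
      have hz := (hψ.memLp j z).integrable_sq
      calc ∫ ω, D.ψ j (D.ξ ω) z' ^ 2 ∂P
          ≤ ∫ ω, (2 * D.ψ j (D.ξ ω) z ^ 2
              + 2 * |D.ψ j (D.ξ ω) z - D.ψ j (D.ξ ω) z'| ^ 2) ∂P := by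
            refine integral_mono (hψ.memLp j z').integrable_sq
              ((hz.const_mul 2).add (hd.const_mul 2)) fun ω => ?_
            simp only [sq_abs]
            nlinarith [sq_nonneg (2 * D.ψ j (D.ξ ω) z - D.ψ j (D.ξ ω) z')]
        _ = 2 * ∫ ω, D.ψ j (D.ξ ω) z ^ 2 ∂P
              + 2 * ∫ ω, |D.ψ j (D.ξ ω) z - D.ψ j (D.ξ ω) z'| ^ 2 ∂P := by
            rw [integral_add (hz.const_mul 2) (hd.const_mul 2), integral_const_mul,
              integral_const_mul]
        _ ≤ _ := by
            have : ∫ ω, |D.ψ j (D.ξ ω) z - D.ψ j (D.ξ ω) z'| ^ 2 ∂P < 1 := hz'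
            linarith
  choose C hC using hone
  refine ⟨∑ j, |C j|, fun j z => (hC j z (Set.mem_univ z)).trans ((le_abs_self _).trans ?_)⟩
  exact Finset.single_le_sum (f := fun j => |C j|) (fun j _ => abs_nonneg _) (Finset.mem_univ j)

variable [MeasurableSpace Ξ] [MeasurableSpace Z] {μ : Measure Z}

variable {C : ℝ}

lemma IsLatentMetricModel.isSecondOrder (hD : D.IsLatentMetricModel P μ)
    (hψ : ∀ j z, MemLp (fun ω => D.ψ j (D.ξ ω) z) 2 P)
    (hC : ∀ j z, ∫ ω, D.ψ j (D.ξ ω) z ^ 2 ∂P ≤ C) (j : Fin p) :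
    IsSecondOrder P (fun ω z => D.ψ j (D.ξ ω) z) C where
  measurable := (hD.measurable_ψ j).comp
    ((hD.measurable_ξ.comp measurable_fst).prodMk measurable_snd)
  memLp := hψ j
  le := hC j

lemma IsLatentMetricModel.indepFun_ξ_z (hD : D.IsLatentMetricModel P μ) (i : Fin n) :
    IndepFun D.ξ (D.z i) P :=
  hD.indep.indep (i := .psi) (j := .z i) (by simp)

lemma IsLatentMetricModel.indepFun_ξ_zTest (hD : D.IsLatentMetricModel P μ) :
    IndepFun D.ξ D.zTest P :=
  hD.indep.indep (i := .psi) (j := .zTest) (by simp)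

variable [IsProbabilityMeasure P]

/-- The feature expansions converge, for the data itself, and for independent test data. -/
lemma ae_hasExpansions [IsProbabilityMeasure μ] [IsSeparable μ] (hp : 1 ≤ p) (hD : D.IsLatentMetricModel P μ)
    (hψ : ∀ j z, MemLp (fun ω => D.ψ j (D.ξ ω) z) 2 P)
    (hC : ∀ j z, ∫ ω, D.ψ j (D.ξ ω) z ^ 2 ∂P ≤ C) (hu : IsEigensystem μ (D.kernel P) lam u)
    (hum : ∀ k, Measurable (posEigen lam u k))
    (hlam : Summable fun k : ℕ => ((k : ℝ) + 1) * lam k) :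
    ∀ᵐ ω ∂P, D.HasExpansions lam u μ ω ∧ ∀ᵐ ω' ∂P, (D.freezeTrain ω).HasExpansions lam u μ ω' := by
  set G : Ξ → Z → Prop := fun x z => ∀ j, Tendsto (fun r : ℕ => ∑ k ∈ Finset.range r,
      (∫ z, D.ψ j x z * posEigen lam u k z ∂μ) * posEigen lam u k z) atTop
      (𝓝 (D.ψ j x z)) with hG
  -- Joint measurability of the convergence event is what allows passing from almost every fixed
  -- position to a random position independent of `ξ`.
  have hGm : MeasurableSet {q : Ξ × Z | G q.1 q.2} := by
    simp only [hG, Set.ofPred_forall]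
    refine MeasurableSet.iInter fun j => measurableSet_tendsto_fun (fun r => ?_) (hD.measurable_ψ j)
    refine Finset.measurable_fun_sum _ fun k _ => Measurable.mul ?_ ((hum k).comp measurable_snd)
    have hm : Measurable fun q : (Ξ × Z) × Z => D.ψ j q.1.1 q.2 * posEigen lam u k q.2 :=
      ((hD.measurable_ψ j).comp
        ((measurable_fst.comp measurable_fst).prodMk measurable_snd)).mul
        ((hum k).comp measurable_snd)
    exact (hm.stronglyMeasurable.integral_prod_right').measurable
  have hKL : ∀ᵐ ω ∂P, ∀ᵐ z ∂μ, G (D.ξ ω) z := by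
    simp only [hG, ae_all_iff]
    exact fun j => ae_ae_tendsto_eigenexpansion hp (hD.isSecondOrder hψ hC) (fun z z' => rfl) hu
      hlam j
  have hlaw : ∀ {Y : Ω → Z}, Measurable Y → P.map Y = μ →
      ∀ᵐ ω ∂P, ∀ᵐ ω' ∂P, G (D.ξ ω) (Y ω') := by
    intro Y hY hYμ
    filter_upwards [hKL] with ω hω
    rw [← hYμ] at hω
    exact ae_of_ae_map hY.aemeasurable hω
  have hz : ∀ᵐ ω ∂P, ∀ i, G (D.ξ ω) (D.z i ω) := ae_all_iff.2 fun i =>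
    ae_of_ae_ae_of_indepFun hD.measurable_ξ (hD.measurable_z i) (hD.indepFun_ξ_z i) hGm
      (hlaw (hD.measurable_z i) (hD.law_z i))
  have hzT' := hlaw hD.measurable_zTest hD.law_zTest
  have hzT : ∀ᵐ ω ∂P, G (D.ξ ω) (D.zTest ω) :=
    ae_of_ae_ae_of_indepFun hD.measurable_ξ hD.measurable_zTest hD.indepFun_ξ_zTest hGm hzT'
  filter_upwards [hz, hzT, hzT'] with ω h1 h2 h3
  refine ⟨fun j => ⟨(hasDot_W_iff hu.nonneg hp ω j _).2 (h2 j),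
    fun i => (hasDot_W_iff hu.nonneg hp ω j _).2 (h1 i j)⟩, ?_⟩
  filter_upwards [h3] with ω' h4
  exact fun j => ⟨(hasDot_W_iff hu.nonneg hp ω j _).2 (h4 j),
    fun i => (hasDot_W_iff hu.nonneg hp ω j _).2 (h1 i j)⟩

/-! ### Finiteness of the perturbation terms. -/

variable {g : Z → ℝ} {ω : Ω}

/-- With the training covariates frozen, the error is a finite sum of functions of `z_test` times
affine functions of `ε`. The former are square integrable because `ψ_j` lies in `L²(μ)` and
`φ(z_test)ᵀ φ(z_i)` is bounded by `C`. -/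
lemma lintegral_gramError_lt_top (hD : D.IsLatentMetricModel P μ)
    (hφm : ∀ k, Measurable fun z => featureMap lam u z k)
    (hφC : ∀ z r, ∑ k ∈ Finset.range r, featureMap lam u z k ^ 2 ≤ C) (γ : ℝ)
    (hexp : ∀ᵐ ω' ∂P, (D.freezeTrain ω).HasExpansions lam u μ ω')
    (hL : ∀ j, MemLp (D.ψ j (D.ξ ω)) 2 μ) :
    ∫⁻ ω', ENNReal.ofReal (|(D.freezeTrain ω).gramError lam u μ γ g ω'| ^ 2) ∂P < ∞ := by
  have hφs : ∀ z, Summable fun k => featureMap lam u z k ^ 2 := fun z =>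
    summable_of_sum_range_le (fun k => sq_nonneg _) (hφC z)
  have hpres : MeasurePreserving D.zTest P μ := ⟨hD.measurable_zTest, hD.law_zTest⟩
  have hψm : ∀ j, Measurable (D.ψ j (D.ξ ω)) := fun j =>
    (hD.measurable_ψ j).comp measurable_prodMk_left
  have hdot : ∀ i, Measurable fun z => seqDot (featureMap lam u z) (D.Φ lam u ω i) := fun i =>
    measurable_seqDot hφm fun _ => measurable_const
  have h := memLp_sum_mul_of_indepFun hD.indepFun_zTest_epsVec
    (f := fun i z => ∑ j, (√(p : ℝ))⁻¹ * D.ψ j (D.ξ ω) (D.z i ω) *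
        ((√(p : ℝ))⁻¹ * D.ψ j (D.ξ ω) z) - seqDot (featureMap lam u z) (D.Φ lam u ω i))
    (g := fun i e => ((D.A γ ω)⁻¹ *ᵥ ((fun l => g (D.z l ω)) + e)) i)
    (fun i => (Finset.measurable_fun_sum _ fun j _ =>
      ((hψm j).const_mul _).const_mul _).sub (hdot i))
    (fun i => measurable_mulVec_add _ _ i)
    (fun i => MemLp.sub (memLp_finsetSum _ fun j _ =>
      (((hL j).comp_measurePreserving hpres).const_mul _).const_mul _) ?_)
    (fun i => hD.memLp_mulVec_eps _ _ i)
  · refine lt_of_eq_of_lt (lintegral_congr_ae ?_) (lintegral_ofReal_abs_sq_lt_top h)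
    filter_upwards [hexp] with ω' hω'
    rw [gramError_eq hφs γ g hω']
    rfl
  · refine MemLp.of_bound ((hdot i).comp hD.measurable_zTest).aestronglyMeasurable C
      (Eventually.of_forall fun ω' => ?_)
    exact abs_seqDot_le (hφC _) (hφC _) (hasDot_of_summable_sq (hφs _) (hφs _))

lemma lintegral_noiseError_lt_top (hD : D.IsLatentMetricModel P μ) (γ : ℝ)
    (hexp : ∀ᵐ ω' ∂P, (D.freezeTrain ω).HasExpansions lam u μ ω')
    (hL : ∀ j, MemLp (D.ψ j (D.ξ ω)) 2 μ) :
    ∫⁻ ω', ENNReal.ofReal (|(D.freezeTrain ω).noiseError lam u μ γ g ω'| ^ 2) ∂P < ∞ := by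
  have hpres : MeasurePreserving D.zTest P μ := ⟨hD.measurable_zTest, hD.law_zTest⟩
  have hψm : ∀ j, Measurable (D.ψ j (D.ξ ω)) := fun j =>
    (hD.measurable_ψ j).comp measurable_prodMk_left
  have h := memLp_sum_mul_of_indepFun hD.indepFun_zTest_epsVec
    (f := fun i z => ∑ j, (√(p : ℝ))⁻¹ * D.ψ j (D.ξ ω) z * D.e i j ω)
    (g := fun i e => ((D.A γ ω)⁻¹ *ᵥ ((fun l => g (D.z l ω)) + e)) i)
    (fun i => Finset.measurable_fun_sum _ fun j _ => ((hψm j).const_mul _).mul_const _)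
    (fun i => measurable_mulVec_add _ _ i)
    (fun i => memLp_finsetSum _ fun j _ =>
      (((hL j).comp_measurePreserving hpres).const_mul _).mul_const _)
    (fun i => hD.memLp_mulVec_eps _ _ i)
  refine lt_of_eq_of_lt (lintegral_congr_ae ?_) (lintegral_ofReal_abs_sq_lt_top h)
  filter_upwards [hexp] with ω' hω'
  rw [noiseError_eq γ g hω']
  rfl

lemma lintegral_testNoiseError_lt_top (hD : D.IsLatentMetricModel P μ) (γ : ℝ) :
    ∫⁻ ω', ENNReal.ofReal (|(D.freezeTrain ω).testNoiseError γ g ω'| ^ 2) ∂P < ∞ := by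
  have h := memLp_sum_mul_of_indepFun hD.indepFun_eTest_epsVec
    (f := fun i e => ∑ j, e j * D.X ω i j)
    (g := fun i e => ((D.A γ ω)⁻¹ *ᵥ ((fun l => g (D.z l ω)) + e)) i)
    (fun i => Finset.measurable_fun_sum _ fun j _ => (measurable_pi_apply j).mul_const _)
    (fun i => measurable_mulVec_add _ _ i)
    (fun i => memLp_finsetSum _ fun j _ => (hD.memLp_eTest j).mul_const _)
    (fun i => hD.memLp_mulVec_eps _ _ i)
  refine lt_of_eq_of_lt (lintegral_congr fun ω' => ?_) (lintegral_ofReal_abs_sq_lt_top h)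
  rw [testNoiseError_eq]
  rfl

end LatentData

/-! ### Combining the four errors. -/

lemma sq_abs_add_four_le (a b c d : ℝ) :
    4⁻¹ * |a + b + c + d| ^ 2 ≤ |a| ^ 2 + |b| ^ 2 + (|c| ^ 2 + |d| ^ 2) := by
  simp only [sq_abs]
  nlinarith [sq_nonneg (a - b), sq_nonneg (a - c), sq_nonneg (a - d), sq_nonneg (b - c),
    sq_nonneg (b - d), sq_nonneg (c - d)]

namespace LatentData

variable {Ω Ξ Z : Type*} {n p : ℕ} {D : LatentData Ω Ξ Z n p} [MeasurableSpace Ω]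
  [MeasurableSpace Ξ] [MeasurableSpace Z] {P : Measure Ω} {μ : Measure Z} [SFinite μ]
  {lam : ℕ → ℝ} {u : ℕ → Z → ℝ} {g : Z → ℝ} {θ : ℕ → ℝ}

/-- Only measurability and the expansions are required of the data, because the lemma is applied to
`freezeTrain`, where the training covariates are constant and no longer follow the model. -/
lemma lintegral_predError_le (hp : 1 ≤ p) (hD : D.IsMeasurable) (h0 : ∀ k, 0 ≤ lam k)
    (hφs : ∀ z, Summable fun k => featureMap lam u z k ^ 2)
    (hφm : ∀ k, Measurable fun z => featureMap lam u z k) (hgm : Measurable g)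
    (hg : ∀ z, g z = seqDot (featureMap lam u z) θ) (γ : ℝ)
    (hexp : ∀ᵐ ω ∂P, D.HasExpansions lam u μ ω) :
    4⁻¹ * ∫⁻ ω, ENNReal.ofReal (|D.predError γ g ω| ^ 2) ∂P
      ≤ ∫⁻ ω, ENNReal.ofReal (|D.ridgeError lam u γ g θ ω| ^ 2) ∂P
        + (∫⁻ ω, ENNReal.ofReal (|D.gramError lam u μ γ g ω| ^ 2) ∂P
          + ENNReal.ofReal (D.σx ^ 2 / p)
            * ∫⁻ ω, ENNReal.ofReal (|D.noiseError lam u μ γ g ω| ^ 2) ∂P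
          + ENNReal.ofReal (D.σx ^ 2 / (p : ℝ) ^ 2)
            * ∫⁻ ω, ENNReal.ofReal (|D.testNoiseError γ g ω| ^ 2) ∂P) := by
  have m1 := ((hD.ridgeError hφm hgm γ θ).abs.pow_const 2).ennreal_ofReal
  have m2 := ((hD.gramError hφm h0 μ hgm γ).abs.pow_const 2).ennreal_ofReal
  have m3 := ((hD.noiseError hφm h0 μ hgm γ).abs.pow_const 2).ennreal_ofReal
  have m4 := ((hD.testNoiseError hgm γ).abs.pow_const 2).ennreal_ofReal
  rw [← lintegral_const_mul _ m3, ← lintegral_const_mul _ m4, ← lintegral_add_left m2,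
    ← lintegral_add_right _ (m4.const_mul _), ← lintegral_add_left m1,
    ← lintegral_const_mul' _ _ (by simp)]
  refine lintegral_mono_ae ?_
  filter_upwards [hexp] with ω hω
  have e4 : (4⁻¹ : ℝ≥0∞) = ENNReal.ofReal 4⁻¹ := by
    rw [ENNReal.ofReal_inv_of_pos (by norm_num)]; norm_num
  rw [e4, ← ENNReal.ofReal_mul (by norm_num), ← ENNReal.ofReal_mul (by positivity),
    ← ENNReal.ofReal_mul (by positivity), ← ENNReal.ofReal_add (by positivity) (by positivity),
    ← ENNReal.ofReal_add (by positivity) (by positivity),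
    ← ENNReal.ofReal_add (by positivity) (by positivity), predError_eq_sum hp hφs hg γ hω]
  refine ENNReal.ofReal_le_ofReal ((sq_abs_add_four_le _ _ _ _).trans_eq ?_)
  simp only [sq_abs, mul_pow, inv_pow, Real.sq_sqrt (Nat.cast_nonneg p)]
  ring

end LatentData

/-! ### Assembly of the main result. -/

theorem lemma1 {Ω Ξ Z : Type*} [MeasurableSpace Ω] [MeasurableSpace Ξ]
    [MetricSpace Z] [CompactSpace Z] [MeasurableSpace Z] [BorelSpace Z]
    (P : Measure Ω) [IsProbabilityMeasure P]
    (μ : Measure Z) [IsProbabilityMeasure μ] [μ.IsOpenPosMeasure]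
    (n p : ℕ) (hp : 1 ≤ p) (D : LatentData Ω Ξ Z n p)
    (hD : D.IsLatentMetricModel P μ) (hψ : D.IsMeanSquareContinuous P)
    (lam : ℕ → ℝ) (u : ℕ → Z → ℝ) (hu : IsEigensystem μ (D.kernel P) lam u)
    (hlam : Summable (fun k : ℕ => ((k : ℝ) + 1) * lam k))
    (g : Z → ℝ) (θ : ℕ → ℝ) (hθ : Summable (fun k => θ k ^ 2))
    (hθ0 : ∀ k, lam k = 0 → θ k = 0) (hg : ∀ z, g z = seqDot (featureMap lam u z) θ)
    (γ : ℝ) (hγ : 0 ≤ γ) :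
    -- the infinite sums that enter the objects below converge
    (∀ z, Summable (fun k => featureMap lam u z k ^ 2)) ∧
    (∀ᵐ ω ∂P, ∀ j, DotConverges (D.φTest lam u ω) (D.W lam u μ ω j) ∧
      ∀ i, DotConverges (D.Φ lam u ω i) (D.W lam u μ ω j)) ∧
    -- the decomposition of the prediction error
    (∀ ω, D.predError γ g ω =
      seqDot (D.φTest lam u ω) (D.thetaHat lam u γ ω (D.y g ω)) - seqDot (D.φTest lam u ω) θ
      + ((p : ℝ)⁻¹ • (D.xTest ω ᵥ* (D.X ω)ᵀ) - seqVecMul (D.φTest lam u ω) (D.Φ lam u ω)ᵀ)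
          ⬝ᵥ ((D.A γ ω)⁻¹ *ᵥ D.y g ω)) ∧
    -- the decomposition of the matrix `A`
    (∀ᵐ ω ∂P, D.A γ ω =
      D.K lam u ω + (D.σx ^ 2 + (n : ℝ) * γ) • (1 : Matrix (Fin n) (Fin n) ℝ)
        + D.Δ lam u μ ω) ∧
    -- the bound on the excess risk, whose right-hand side is finite
    (∀ᵐ ω ∂P, 4⁻¹ * D.excessRisk P γ g ω ≤
        D.B lam u γ θ ω + D.V lam u P γ ω
          + (D.S₁ lam u P μ γ g ω + D.S₂ lam u P μ γ g ω + D.S₃ P γ g ω)) ∧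
    (∀ᵐ ω ∂P, D.B lam u γ θ ω + D.V lam u P γ ω
        + (D.S₁ lam u P μ γ g ω + D.S₂ lam u P μ γ g ω + D.S₃ P γ g ω) < ∞) := by
  -- The same `C` bounds the second moments of the `ψ_j` and, in `hφC`, the squared feature norms,
  -- both uniformly in the position.
  obtain ⟨C, hC⟩ := hψ.exists_bound
  have hF := hD.isSecondOrder hψ.memLp hC
  have h0 := hu.nonneg
  have hum : ∀ k, Measurable (posEigen lam u k) :=
    hu.measurable_posEigen (measurable_kernel hF fun z z' => rfl)
  have hφm : ∀ k, Measurable fun z => featureMap lam u z k := fun k => by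
    simp only [featureMap_eq_posEigen h0]
    exact (hum k).const_mul _
  have hφC : ∀ z r, ∑ k ∈ Finset.range r, featureMap lam u z k ^ 2 ≤ C := fun z r => by
    simp only [featureMap_eq_posEigen h0, mul_pow, Real.sq_sqrt (h0 _)]
    exact sum_lam_mul_posEigen_sq_le hp hF (fun z z' => rfl) hu z r
  have hφs : ∀ z, Summable fun k => featureMap lam u z k ^ 2 := fun z =>
    summable_of_sum_range_le (fun k => sq_nonneg _) (hφC z)
  have hgm : Measurable g := by
    rw [funext hg]
    exact measurable_seqDot hφm fun _ => measurable_const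
  have hexp := LatentData.ae_hasExpansions hp hD hψ.memLp hC hu hum hlam
  have hL : ∀ᵐ ω ∂P, ∀ j, MemLp (D.ψ j (D.ξ ω)) 2 μ :=
    ae_all_iff.2 fun j => (hF j).ae_memLp μ
  have hV := LatentData.V_ae_eq hD hφm γ
  have hS₁ := LatentData.S₁_ae_eq hD hφm h0 hgm γ
  have hS₂ := LatentData.S₂_ae_eq hD hφm h0 hgm γ
  have hS₃ := LatentData.S₃_ae_eq hD hgm γ
  refine ⟨hφs, ?_, LatentData.predError_eq hφs hg γ, ?_, ?_, ?_⟩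
  · filter_upwards [hexp] with ω hω j
    exact ⟨⟨_, (hω.1 j).1⟩, fun i => ⟨_, (hω.1 j).2 i⟩⟩
  · filter_upwards [hexp] with ω hω using LatentData.A_eq hp hφs γ hω.1
  · filter_upwards [hexp, hV, hS₁, hS₂, hS₃, LatentData.excessRisk_ae_eq hD hgm γ]
      with ω hω e1 e2 e3 e4 e5
    rw [e1, e2, e3, e4, e5]
    refine (LatentData.lintegral_predError_le hp (hD.isMeasurable.freezeTrain ω) h0 hφs hφm hgm hg
      γ hω.2).trans ?_
    exact add_le_add_left (LatentData.lintegral_ridgeError_le hD hu hφm hφC hθ hg γ ω) _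
  · filter_upwards [hexp, hV, hS₁, hS₂, hS₃, hL] with ω hω e1 e2 e3 e4 hLω
    rw [e1, e2, e3, e4]
    exact ENNReal.add_lt_top.2 ⟨ENNReal.add_lt_top.2
      ⟨LatentData.B_lt_top hu.antitone h0 hφC hθ γ ω,
        LatentData.lintegral_lamNormSq_lt_top hD hu.antitone h0 hφC γ ω⟩,
      ENNReal.add_lt_top.2 ⟨ENNReal.add_lt_top.2
        ⟨LatentData.lintegral_gramError_lt_top hD hφm hφC γ hω.2 hLω,
          ENNReal.mul_lt_top ENNReal.ofReal_lt_top
            (LatentData.lintegral_noiseError_lt_top hD γ hω.2 hLω)⟩,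
        ENNReal.mul_lt_top ENNReal.ofReal_lt_top
          (LatentData.lintegral_testNoiseError_lt_top hD γ)⟩⟩
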